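/- Let $D\ge 1$, let $X_T$ be an $\mathbb{R}^D$-valued random vector (the time-$T$ value of the driving process of the log asset prices), let $f:\mathbb{R}^D\to[0,\infty)$ be measurable, and let $$V(s)=\mathbb{E}\,[f(X_T-s)],\qquad s\in\mathbb{R}^D,$$ be the option price as a function of $s=(-\log S_0^1,\dots,-\log S_0^D)$, where $S_0^i$ are the initial asset prices. Let $R\in\mathbb{R}^D$, let $g(x)=e^{-\langle R,x\rangle}f(x)$ be the dampened payoff, let $P_{X_T}$ be the law of $X_T$, and put $\phi_{X_T}(z)=\mathbb{E}[e^{i\langle z,X_T\rangle}]$ with $\langle z,x\rangle=\sum_j z_jx_j$ for $z \in \mathbb{C}^D$. Assume: (B1) $g\in L^1(\mathbb{R}^D)$; (B2) the Fourier transform $u\mapsto\int e^{i\langle u,x\rangle}e^{\langle R,x\rangle}P_{X_T}(dx)$ of the measure $e^{\langle R,\cdot\rangle}P_{X_T}$ is in $L^1(\mathbb{R}^D)$; (B3) $\mathbb{E}[e^{\langle R,X_T\rangle}]<\infty$; (B4) there are $c_1,c_2>0$ and $\alpha\in(1,2]$ with $|\phi_{X_T}(u-iR)|\le c_1e^{-c_2\|u\|_2^\alpha}$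 for all $u\in\mathbb{R}^D$. Put $\vartheta=\frac{\alpha}{\alpha-1}$ and $\Omega_L=[-L,L]^D$. Then $V(s)$ is a finite expectation for every $s\in\mathbb{R}^D$, and the following hold. 1. $\vartheta\ge 2$, and there are constants $a,b>0$ such that for all $L>0$ and all $N=(n+1)^D$ with an integer $n\ge 1$, $$\sup_{s\in\Omega_L}|V(s)-\mathbf{I}_NV(s)|\le a\,e^{b(L^{\vartheta}-\sqrt[D]{N})},$$ where $\mathbf{I}_NV$ is the tensor-product Chebyshev interpolant of $V$ on $\Omega_L$ of degree $n$ in each variable, at the $N$ points with coordinates $L\cos(\pi k_i/n)$, $0\le k_i\le n$. 2. For every $\varrho\in(1,\infty)^D$ there are constants $c_3,c_4>0$ such that for every $L>0$ the function $V|_{\Omega_L}$ has an analytic extension to the generalized Bernstein ellipse $B(\Omega_L,\varrho)=\prod_{i=1}^D L\cdot\mathcal{E}(\varrho_i)$ whose modulus is bounded there by $c_3e^{c_4L^{\vartheta}}$. Here $\mathcal{E}(r)\subset\mathbb{C}$ is the open region bounded by the ellipse with foci $\pm1$ whose semi-axes have lengths summing to $r$. -/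

import Mathlib

open MeasureTheory

noncomputable section

/-- `ℝ^D` with the Euclidean norm and inner product. -/
abbrev RVec (D : ℕ) : Type := EuclideanSpace ℝ (Fin D)

/-- The time-`0` price `V(s) = E[f(X_T - s)]`, where `s i = - log S₀ⁱ` and `f` is the payoff
as a function of the terminal log-prices. -/
def optionPrice {D : ℕ} {Ω : Type*} [MeasurableSpace Ω] (P : Measure Ω)
    (X : Ω → RVec D) (f : RVec D → ℝ) (s : RVec D) : ℝ :=
  ∫ ω, f (X ω - s) ∂P

/-- The dampened payoff `g(x) = e^{-⟨R,x⟩} f(x)`. -/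
def dampenedPayoff {D : ℕ} (R : RVec D) (f : RVec D → ℝ) (x : RVec D) : ℝ :=
  Real.exp (-(inner ℝ R x)) * f x

/-- The measure `e^{⟨R,·⟩} P_X`, where `P_X` is the law of `X`. -/
def dampenedLaw {D : ℕ} {Ω : Type*} [MeasurableSpace Ω] (P : Measure Ω)
    (X : Ω → RVec D) (R : RVec D) : Measure (RVec D) :=
  (P.map X).withDensity fun x => ENNReal.ofReal (Real.exp (inner ℝ R x))

/-- The characteristic function `φ_X(z) = E[e^{i⟨z,X⟩}]` at a complex argument `z ∈ ℂ^D`, with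
the bilinear pairing `⟨z,x⟩ = ∑ⱼ zⱼ xⱼ`. -/
def complexCharFun {D : ℕ} {Ω : Type*} [MeasurableSpace Ω] (P : Measure Ω)
    (X : Ω → RVec D) (z : Fin D → ℂ) : ℂ :=
  ∫ ω, Complex.exp (Complex.I * ∑ j, z j * ((X ω j : ℝ) : ℂ)) ∂P

/-- The hypercube `Ω_L = [-L,L]^D`. -/
def cube (D : ℕ) (L : ℝ) : Set (RVec D) :=
  {s | ∀ i, s i ∈ Set.Icc (-L) L}

/-- The affine map `τ(z) = b + (a - b)/2 * (1 - z)`, taking `[-1,1]` onto `[a,b]`. -/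
def domainTransform {𝕜 : Type*} [Field 𝕜] (a b z : 𝕜) : 𝕜 :=
  b + (a - b) / 2 * (1 - z)

/-- The inverse of `domainTransform a b` (for `a ≠ b`). -/
def domainTransformInv {𝕜 : Type*} [Field 𝕜] (a b y : 𝕜) : 𝕜 :=
  1 - 2 * (b - y) / (b - a)

/-- The Bernstein ellipse `𝓔([-1,1], ϱ)` for `ϱ > 1`: the open region bounded by the ellipse with
foci `±1` whose semi-axes sum to `ϱ`. The semi-axes are `A = (ϱ + ϱ⁻¹)/2`, `B = (ϱ - ϱ⁻¹)/2`,
being the solution of `A + B = ϱ` and `A ^ 2 - B ^ 2 = 1`. -/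
def bernsteinEllipse (ϱ : ℝ) : Set ℂ :=
  {z | (z.re / ((ϱ + ϱ⁻¹) / 2)) ^ 2 + (z.im / ((ϱ - ϱ⁻¹) / 2)) ^ 2 < 1}

/-- The generalized Bernstein ellipse `B([-L,L]^D, ϱ) = ∏ᵢ 𝓔([-L,L], ϱᵢ)`, where `𝓔([a,b], ϱ)` is
the image of `𝓔([-1,1], ϱ)` under the affine map `τ`. -/
def generalizedBernsteinEllipse (D : ℕ) (L : ℝ) (ϱ : Fin D → ℝ) : Set (Fin D → ℂ) :=
  {z | ∀ i, z i ∈ domainTransform (-(L : ℂ)) (L : ℂ) '' bernsteinEllipse (ϱ i)}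

/-- The tensor Chebyshev point of `[-1,1]^D` of degree `n` with multi-index `k`, having the
coordinates `cos (π kᵢ / n)`. -/
def chebNode {D : ℕ} (n : ℕ) (k : Fin D → Fin (n + 1)) : RVec D :=
  WithLp.toLp 2 fun i => Real.cos (Real.pi * ((k i : ℕ) : ℝ) / n)

/-- The weight of the double-primed sum: each first and each last summand is halved. -/
def chebWeight {D : ℕ} (n : ℕ) (k : Fin D → Fin (n + 1)) : ℝ :=
  ∏ i, if (k i : ℕ) = 0 ∨ (k i : ℕ) = n then (1 / 2 : ℝ) else 1

/-- The tensor Chebyshev polynomial `T_j(x) = ∏ᵢ T_{jᵢ}(xᵢ)`. -/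
def chebTensor {D : ℕ} (n : ℕ) (j : Fin D → Fin (n + 1)) (x : RVec D) : ℝ :=
  ∏ i, (Polynomial.Chebyshev.T ℝ ((j i : ℕ) : ℤ)).eval (x i)

/-- The Chebyshev coefficient
`c_j = (∏ᵢ 2^{1_{0 < jᵢ < n}} / n) ∑''_k h(ζ^k) T_j(ζ^k)`. -/
def chebCoeff {D : ℕ} (n : ℕ) (h : RVec D → ℝ) (j : Fin D → Fin (n + 1)) : ℝ :=
  (∏ i, (if 0 < (j i : ℕ) ∧ (j i : ℕ) < n then (2 : ℝ) else 1) / n) *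
    ∑ k : Fin D → Fin (n + 1), chebWeight n k * (h (chebNode n k) * chebTensor n j (chebNode n k))

/-- The tensor-product Chebyshev interpolant on `[-1,1]^D`, of degree `n` in each variable. -/
def chebInterpUnit {D : ℕ} (n : ℕ) (h : RVec D → ℝ) (x : RVec D) : ℝ :=
  ∑ j : Fin D → Fin (n + 1), chebCoeff n h j * chebTensor n j x

/-- The tensor-product Chebyshev interpolant of `v` on `[-L,L]^D`, of degree `n` in each variable,
with `(n + 1) ^ D` interpolation points: the function `v ∘ τ` is interpolated on `[-1,1]^D`. -/
def chebInterp {D : ℕ} (L : ℝ) (n : ℕ) (v : RVec D → ℝ) (s : RVec D) : ℝ :=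
  chebInterpUnit n (fun x => v (WithLp.toLp 2 fun i => domainTransform (-L) L (x i)))
    (WithLp.toLp 2 fun i => domainTransformInv (-L) L (s i))

end

/-!
The proof rests on a Fourier representation of the price. The finite measure
`ν = e^{⟨R,·⟩} P_X` has an integrable characteristic function, hence a bounded continuous density,
the inverse Fourier transform of that function (`integral_eq_integral_fourierDensity_mul`).
Writing `V(s) = e^{-⟨R,s⟩} ∫ g(x - s) ν(dx)` with the dampened payoff `g` and applying Fubini's
theorem gives `V(s) = ∫ ψ(v) exp (∑ⱼ (2πi vⱼ - Rⱼ) sⱼ) dv`, where `|ψ(v)| ≤ C exp (-c ‖v‖ ^ α)`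
(`optionPrice_fourier_representation`). Thus the price is a superposition of tensor-product
exponentials, and by Young's inequality the weight has exponential moments
`∫ exp (-c ‖v‖ ^ α + t ‖v‖) dv ≤ K exp (C t ^ ϑ)` (`exists_integral_exp_neg_rpow_add_le`).

The representation makes sense for complex `s` and yields an entire extension
(`analyticOnNhd_integral_mul_exp`). On the generalized Bernstein ellipse `|sⱼ|` is at most a
constant times `L`, and the moment bound with `t` proportional to `L` gives the growth
`exp (c₄ L ^ ϑ)` (`exists_norm_integral_dampedPhase_le`).

For the interpolation error, interpolation is linear and maps product functions to products, so
it suffices to interpolate the one-dimensional exponentials `x ↦ exp (w x)`. Their Chebyshev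
coefficients are Laurent coefficients of `exp (w (z + z⁻¹) / 2)`, bounded by
`exp (|Re w| A + |Im w| B) ϱ ^ (-k)` with the semi-axes `A`, `B` of the Bernstein ellipse, and
polynomials of degree at most `n` are reproduced (`exists_norm_exp_sub_interp_le`). Integration
against `ψ` turns `exp (|Im w| B)`, with `Im w` proportional to `L v`, into `exp (C (L B) ^ ϑ)`,
whereas `|Re w| A` contributes only a multiple of `L`. The estimate asks for one constant `b` both
in the decay in `n` and in the growth in `L`. With `ϱ = e^{4b}` the decay rate is at least `b`,
while `B = sinh (4b)` enters with the power `ϑ ≥ 2`, so that `C B ^ ϑ ≤ b / 2` once `b` is small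
(`exists_abs_sub_chebInterp_le`).
-/

/-! ### One-dimensional Chebyshev interpolation -/

/-- The `k`-th cardinal function of Chebyshev interpolation of degree `n` on `[-1,1]`: the
coefficient of the nodal value `h (cos (π k / n))` in the interpolant of `h`. -/
noncomputable def chebCardinal (n : ℕ) (k : Fin (n + 1)) (x : ℝ) : ℝ :=
  ∑ j : Fin (n + 1), (if 0 < (j : ℕ) ∧ (j : ℕ) < n then (2 : ℝ) else 1) / n *
    ((if (k : ℕ) = 0 ∨ (k : ℕ) = n then (1 / 2 : ℝ) else 1) *
      (Polynomial.Chebyshev.T ℝ ((j : ℕ) : ℤ)).eval (Real.cos (Real.pi * ((k : ℕ) : ℝ) / n)) *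
      (Polynomial.Chebyshev.T ℝ ((j : ℕ) : ℤ)).eval x)

/-- The tensor interpolant is the combination of the nodal values with products of
one-dimensional cardinal functions. -/
theorem chebInterpUnit_eq_sum_cardinal {D : ℕ} (n : ℕ) (h : RVec D → ℝ) (x : RVec D) :
    chebInterpUnit n h x
      = ∑ k : Fin D → Fin (n + 1), h (chebNode n k) * ∏ i, chebCardinal n (k i) (x i) := by
  unfold chebInterpUnit chebCoeff chebCardinal
  simp_rw [Finset.mul_sum, Finset.sum_mul]
  rw [Finset.sum_comm]
  refine Finset.sum_congr rfl fun k _ => ?_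
  rw [Finset.prod_univ_sum, Fintype.piFinset_univ, Finset.mul_sum]
  refine Finset.sum_congr rfl fun j _ => ?_
  simp only [chebWeight, chebTensor, chebNode, Finset.prod_mul_distrib]
  ring

theorem sum_endpoint_halved {n : ℕ} (hn : 1 ≤ n) (g : ℕ → ℝ) :
    ∑ k : Fin (n + 1), (if (k : ℕ) = 0 ∨ (k : ℕ) = n then (1 / 2 : ℝ) else 1) * g k
      = ∑ k ∈ Finset.range n, (g k + g (k + 1)) / 2 := by
  obtain ⟨m, rfl⟩ : ∃ m, n = m + 1 := ⟨n - 1, by omega⟩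
  rw [Fin.sum_univ_eq_sum_range
    (fun k => (if k = 0 ∨ k = m + 1 then (1 / 2 : ℝ) else 1) * g k) (m + 1 + 1),
    Finset.sum_range_succ, Finset.sum_range_succ']
  have h1 : ∀ k ∈ Finset.range m,
      (if k + 1 = 0 ∨ k + 1 = m + 1 then (1 / 2 : ℝ) else 1) * g (k + 1) = g (k + 1) := by
    intro k hk
    rw [Finset.mem_range] at hk
    rw [if_neg (by omega), one_mul]
  rw [Finset.sum_congr rfl h1, ← Finset.sum_div, Finset.sum_add_distrib,
    Finset.sum_range_succ' g m, Finset.sum_range_succ (fun k => g (k + 1)) m]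
  simp
  ring

theorem two_mul_sin_half_mul_sum_cos {n : ℕ} (hn : 1 ≤ n) (θ : ℝ) :
    2 * Real.sin (θ / 2) *
      ∑ k : Fin (n + 1), (if (k : ℕ) = 0 ∨ (k : ℕ) = n then (1 / 2 : ℝ) else 1) *
        Real.cos ((k : ℕ) * θ) = Real.cos (θ / 2) * Real.sin (n * θ) := by
  rw [sum_endpoint_halved hn (fun k => Real.cos ((k : ℕ) * θ)), Finset.mul_sum]
  have key : ∀ k ∈ Finset.range n, 2 * Real.sin (θ / 2) *
      ((Real.cos ((k : ℕ) * θ) + Real.cos (((k + 1 : ℕ) : ℝ) * θ)) / 2)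
      = Real.cos (θ / 2) * Real.sin (((k + 1 : ℕ) : ℝ) * θ)
        - Real.cos (θ / 2) * Real.sin ((k : ℕ) * θ) := by
    intro k _
    have hab : ∀ a b : ℝ, 2 * Real.sin b * ((Real.cos (a - b) + Real.cos (a + b)) / 2)
        = Real.cos b * Real.sin (a + b) - Real.cos b * Real.sin (a - b) := by
      intro a b
      rw [Real.cos_sub, Real.cos_add, Real.sin_sub, Real.sin_add]
      ring
    have := hab ((k : ℝ) * θ + θ / 2) (θ / 2)
    rw [show (k : ℝ) * θ + θ / 2 - θ / 2 = k * θ by ring,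
      show (k : ℝ) * θ + θ / 2 + θ / 2 = ((k + 1 : ℕ) : ℝ) * θ by push_cast; ring] at this
    exact this
  rw [Finset.sum_congr rfl key,
    Finset.sum_range_sub (fun k : ℕ => Real.cos (θ / 2) * Real.sin ((k : ℝ) * θ))]
  simp

theorem sum_cos_chebyshev_nodes {n : ℕ} (hn : 1 ≤ n) {m : ℕ} (hm : m ≤ 2 * n) :
    ∑ k : Fin (n + 1), (if (k : ℕ) = 0 ∨ (k : ℕ) = n then (1 / 2 : ℝ) else 1) *
        Real.cos ((k : ℕ) * (m * Real.pi / n)) = if m = 0 ∨ m = 2 * n then (n : ℝ) else 0 := by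
  have hn0 : (n : ℝ) ≠ 0 := by positivity
  split_ifs with h
  · have hc : ∀ k : ℕ, Real.cos ((k : ℕ) * (m * Real.pi / n)) = 1 := by
      intro k
      rcases h with rfl | rfl
      · simp
      · rw [show (k : ℝ) * (((2 * n : ℕ) : ℝ) * Real.pi / n) = (k : ℕ) * (2 * Real.pi) by
          push_cast; field_simp]
        exact Real.cos_nat_mul_two_pi k
    simp_rw [hc]
    have := sum_endpoint_halved hn (fun _ => 1)
    rw [this]
    simp
  · push Not at h
    have h1 := two_mul_sin_half_mul_sum_cos hn (m * Real.pi / n)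
    rw [show (n : ℝ) * (m * Real.pi / n) = m * Real.pi by field_simp, Real.sin_nat_mul_pi,
      mul_zero] at h1
    have hs : 0 < Real.sin (m * Real.pi / n / 2) := by
      have hm0 : (0 : ℝ) < m := by exact_mod_cast Nat.pos_of_ne_zero h.1
      have hm1 : (m : ℝ) < 2 * n := by exact_mod_cast lt_of_le_of_ne hm h.2
      have hpos : (0 : ℝ) < n := by positivity
      apply Real.sin_pos_of_pos_of_lt_pi
      · have := Real.pi_pos
        positivity
      · rw [div_div, div_lt_iff₀ (by positivity)]
        nlinarith [Real.pi_pos]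
    rcases mul_eq_zero.1 h1 with h2 | h2
    · linarith
    · exact h2

/-- Discrete orthogonality of the Chebyshev polynomials at the nodes `cos (π k / n)`. -/
theorem chebyshev_discrete_orthogonality {n : ℕ} (hn : 1 ≤ n) {j m : ℕ} (hj : j ≤ n)
    (hm : m ≤ n) :
    ∑ k : Fin (n + 1), (if (k : ℕ) = 0 ∨ (k : ℕ) = n then (1 / 2 : ℝ) else 1) *
      ((Polynomial.Chebyshev.T ℝ (j : ℤ)).eval (Real.cos (Real.pi * ((k : ℕ) : ℝ) / n)) *
       (Polynomial.Chebyshev.T ℝ (m : ℤ)).eval (Real.cos (Real.pi * ((k : ℕ) : ℝ) / n)))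
      = if j = m then (n : ℝ) / (if 0 < j ∧ j < n then 2 else 1) else 0 := by
  wlog hjm : m ≤ j generalizing j m
  · have h := this hm hj (by omega)
    rw [if_neg (by omega)] at h
    rw [if_neg (by omega), ← h]
    exact Finset.sum_congr rfl fun k _ => by ring
  have e : ∀ k : Fin (n + 1), (if (k : ℕ) = 0 ∨ (k : ℕ) = n then (1 / 2 : ℝ) else 1) *
      ((Polynomial.Chebyshev.T ℝ (j : ℤ)).eval (Real.cos (Real.pi * ((k : ℕ) : ℝ) / n)) *
       (Polynomial.Chebyshev.T ℝ (m : ℤ)).eval (Real.cos (Real.pi * ((k : ℕ) : ℝ) / n)))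
      = ((if (k : ℕ) = 0 ∨ (k : ℕ) = n then (1 / 2 : ℝ) else 1) *
          Real.cos ((k : ℕ) * ((j + m : ℕ) * Real.pi / n)) +
        (if (k : ℕ) = 0 ∨ (k : ℕ) = n then (1 / 2 : ℝ) else 1) *
          Real.cos ((k : ℕ) * ((j - m : ℕ) * Real.pi / n))) / 2 := by
    intro k
    rw [Polynomial.Chebyshev.T_real_cos, Polynomial.Chebyshev.T_real_cos,
      show ((k : ℕ) : ℝ) * (((j + m : ℕ) : ℝ) * Real.pi / n)
        = ((j : ℤ) : ℝ) * (Real.pi * (k : ℕ) / n) + ((m : ℤ) : ℝ) * (Real.pi * (k : ℕ) / n) by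
          push_cast; ring,
      show ((k : ℕ) : ℝ) * (((j - m : ℕ) : ℝ) * Real.pi / n)
        = ((j : ℤ) : ℝ) * (Real.pi * (k : ℕ) / n) - ((m : ℤ) : ℝ) * (Real.pi * (k : ℕ) / n) by
          rw [Nat.cast_sub hjm]; push_cast; ring,
      Real.cos_add, Real.cos_sub]
    ring
  rw [Finset.sum_congr rfl fun k _ => e k, ← Finset.sum_div, Finset.sum_add_distrib,
    sum_cos_chebyshev_nodes hn (by omega), sum_cos_chebyshev_nodes hn (by omega)]
  by_cases h : j = m
  · subst h
    by_cases h0 : 0 < j ∧ j < n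
    · rw [if_neg (by omega), if_pos (by omega), if_pos rfl, if_pos h0]
      ring
    · rw [if_pos (by omega), if_pos (by omega), if_pos rfl, if_neg h0]
      ring
  · rw [if_neg (by omega), if_neg (by omega), if_neg h]
    ring

/-- Chebyshev interpolation of degree `n` reproduces `T_m` for `m ≤ n`. -/
theorem sum_T_mul_chebCardinal {n : ℕ} (hn : 1 ≤ n) {m : ℕ} (hm : m ≤ n) (x : ℝ) :
    ∑ k : Fin (n + 1),
      (Polynomial.Chebyshev.T ℝ (m : ℤ)).eval (Real.cos (Real.pi * ((k : ℕ) : ℝ) / n)) *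
        chebCardinal n k x = (Polynomial.Chebyshev.T ℝ (m : ℤ)).eval x := by
  have hn0 : (n : ℝ) ≠ 0 := by positivity
  unfold chebCardinal
  simp_rw [Finset.mul_sum]
  rw [Finset.sum_comm]
  have e : ∀ j : Fin (n + 1), ∑ k : Fin (n + 1),
      (Polynomial.Chebyshev.T ℝ (m : ℤ)).eval (Real.cos (Real.pi * ((k : ℕ) : ℝ) / n)) *
      ((if 0 < (j : ℕ) ∧ (j : ℕ) < n then (2 : ℝ) else 1) / n *
        ((if (k : ℕ) = 0 ∨ (k : ℕ) = n then (1 / 2 : ℝ) else 1) *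
          (Polynomial.Chebyshev.T ℝ ((j : ℕ) : ℤ)).eval (Real.cos (Real.pi * ((k : ℕ) : ℝ) / n)) *
          (Polynomial.Chebyshev.T ℝ ((j : ℕ) : ℤ)).eval x))
      = if (j : ℕ) = m then (Polynomial.Chebyshev.T ℝ (m : ℤ)).eval x else 0 := by
    intro j
    have h := chebyshev_discrete_orthogonality hn (Nat.lt_succ_iff.1 j.2) hm
    calc _ = (if 0 < (j : ℕ) ∧ (j : ℕ) < n then (2 : ℝ) else 1) / n *
          (Polynomial.Chebyshev.T ℝ ((j : ℕ) : ℤ)).eval x *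
            (if (j : ℕ) = m then (n : ℝ) / (if 0 < (j : ℕ) ∧ (j : ℕ) < n then 2 else 1)
              else 0) := by
          rw [← h, Finset.mul_sum]
          exact Finset.sum_congr rfl fun k _ => by ring
      _ = _ := by
          by_cases hjm : (j : ℕ) = m
          · rw [if_pos hjm, if_pos hjm, ← hjm]
            split_ifs <;> field_simp
          · rw [if_neg hjm, if_neg hjm, mul_zero]
  rw [Finset.sum_congr rfl fun j _ => e j,
    Fin.sum_univ_eq_sum_range
      (fun j => if j = m then (Polynomial.Chebyshev.T ℝ (m : ℤ)).eval x else 0) (n + 1),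
    Finset.sum_ite_eq', if_pos (Finset.mem_range.2 (by omega))]

theorem abs_chebCardinal_le {n : ℕ} (hn : 1 ≤ n) (k : Fin (n + 1)) {x : ℝ} (hx : |x| ≤ 1) :
    |chebCardinal n k x| ≤ 4 := by
  have hn1 : (1 : ℝ) ≤ n := by exact_mod_cast hn
  have hn0 : (0 : ℝ) < n := by linarith
  have hterm : ∀ j : Fin (n + 1), |(if 0 < (j : ℕ) ∧ (j : ℕ) < n then (2 : ℝ) else 1) / n *
    ((if (k : ℕ) = 0 ∨ (k : ℕ) = n then (1 / 2 : ℝ) else 1) *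
      (Polynomial.Chebyshev.T ℝ ((j : ℕ) : ℤ)).eval (Real.cos (Real.pi * ((k : ℕ) : ℝ) / n)) *
      (Polynomial.Chebyshev.T ℝ ((j : ℕ) : ℤ)).eval x)| ≤ 2 / n * (1 * 1 * 1) := by
    intro j
    have h1 : |(if 0 < (j : ℕ) ∧ (j : ℕ) < n then (2 : ℝ) else 1)| ≤ 2 := by
      split_ifs <;> norm_num
    have h2 : |(if (k : ℕ) = 0 ∨ (k : ℕ) = n then (1 / 2 : ℝ) else 1)| ≤ 1 := by
      split_ifs <;> norm_num [abs_le]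
    have h3 := Polynomial.Chebyshev.abs_eval_T_real_le_one ((j : ℕ) : ℤ)
      (Real.abs_cos_le_one (Real.pi * ((k : ℕ) : ℝ) / n))
    have h4 := Polynomial.Chebyshev.abs_eval_T_real_le_one ((j : ℕ) : ℤ) hx
    rw [abs_mul, abs_mul, abs_mul, abs_div, abs_of_pos hn0]
    gcongr
  calc |chebCardinal n k x| ≤ ∑ j : Fin (n + 1), 2 / (n : ℝ) * (1 * 1 * 1) :=
        (Finset.abs_sum_le_sum_abs _ _).trans (Finset.sum_le_sum fun j _ => hterm j)
    _ ≤ 4 := by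
        simp only [Finset.sum_const, Finset.card_univ, Fintype.card_fin, nsmul_eq_mul, mul_one]
        push_cast
        rw [mul_div_assoc', div_le_iff₀ hn0]
        linarith

/-! ### Chebyshev expansion of the exponential -/

/-- On the circle `|z| = r` the Joukowski map runs through an ellipse with semi-axes
`(r + r⁻¹) / 2` and `|r - r⁻¹| / 2`. -/
theorem norm_exp_mul_joukowski_le (w : ℂ) {r : ℝ} (hr : 0 < r) {z : ℂ} (hz : ‖z‖ = r) :
    ‖Complex.exp (w * ((z + z⁻¹) / 2))‖
      ≤ Real.exp (|w.re| * ((r + r⁻¹) / 2) + |w.im| * (|r - r⁻¹| / 2)) := by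
  have hns : Complex.normSq z = r ^ 2 := by rw [Complex.normSq_eq_norm_sq, hz]
  have hre : ((z + z⁻¹) / 2).re = z.re / r * ((r + r⁻¹) / 2) := by
    simp only [Complex.div_ofNat_re, Complex.add_re, Complex.inv_re, hns]
    field_simp
  have him : ((z + z⁻¹) / 2).im = z.im / r * ((r - r⁻¹) / 2) := by
    simp only [Complex.div_ofNat_im, Complex.add_im, Complex.inv_im, hns]
    field_simp
    ring
  have h1 : |z.re / r| ≤ 1 := by
    rw [abs_div, abs_of_pos hr, div_le_one hr, ← hz]
    exact Complex.abs_re_le_norm z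
  have h2 : |z.im / r| ≤ 1 := by
    rw [abs_div, abs_of_pos hr, div_le_one hr, ← hz]
    exact Complex.abs_im_le_norm z
  rw [Complex.norm_exp, Complex.mul_re, hre, him]
  apply Real.exp_le_exp.2
  have hA : 0 < (r + r⁻¹) / 2 := by positivity
  have h3 : w.re * (z.re / r * ((r + r⁻¹) / 2)) ≤ |w.re| * ((r + r⁻¹) / 2) := by
    refine (le_abs_self _).trans ?_
    rw [abs_mul, abs_mul, abs_of_pos hA]
    exact mul_le_mul_of_nonneg_left (mul_le_of_le_one_left hA.le h1) (abs_nonneg _)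
  have h4 : -(w.im * (z.im / r * ((r - r⁻¹) / 2))) ≤ |w.im| * (|r - r⁻¹| / 2) := by
    refine (neg_le_abs _).trans ?_
    rw [abs_mul, abs_mul, abs_div (r - r⁻¹), abs_two]
    exact mul_le_mul_of_nonneg_left
      (mul_le_of_le_one_left (by positivity) h2) (abs_nonneg _)
  linarith

/-- The Laurent coefficients `∮ z^(-k-1) exp (w (z + z⁻¹) / 2) dz` do not depend on the radius of
the circle. -/
theorem circleIntegral_zpow_mul_exp_joukowski (w : ℂ) (k : ℤ) {r s : ℝ} (hr : 0 < r)
    (hs : 0 < s) :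
    (∮ z in C(0, r), z ^ (-k - 1) * Complex.exp (w * ((z + z⁻¹) / 2)))
      = ∮ z in C(0, s), z ^ (-k - 1) * Complex.exp (w * ((z + z⁻¹) / 2)) := by
  wlog h : s ≤ r generalizing r s
  · exact (this hs hr (not_le.1 h).le).symm
  have hd : ∀ z : ℂ, z ≠ 0 →
      DifferentiableAt ℂ (fun z => z ^ (-k - 1) * Complex.exp (w * ((z + z⁻¹) / 2))) z := by
    intro z hz
    refine (differentiableAt_zpow.2 (Or.inl hz)).mul (DifferentiableAt.cexp ?_)
    exact ((differentiableAt_id.add (differentiableAt_inv hz)).div_const 2).const_mul w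
  refine Complex.circleIntegral_eq_of_differentiable_on_annulus_off_countable hs h
    Set.countable_empty ?_ ?_
  · intro z hz
    refine (hd z ?_).continuousAt.continuousWithinAt
    rintro rfl
    exact hz.2 (Metric.mem_ball_self hs)
  · intro z hz
    refine hd z ?_
    rintro rfl
    exact hz.1.2 (Metric.mem_closedBall_self hs.le)

instance fact_two_pi_pos : Fact (0 < 2 * Real.pi) := ⟨Real.two_pi_pos⟩

/-- The function `t ↦ exp (w cos t)` on the circle `ℝ / 2πℤ`. -/
noncomputable def expCosCircle (w : ℂ) : C(AddCircle (2 * Real.pi), ℂ) where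
  toFun t := Complex.exp (w * (((AddCircle.toCircle t : ℂ).re : ℝ) : ℂ))
  continuous_toFun := by
    have := AddCircle.continuous_toCircle (T := 2 * Real.pi)
    fun_prop

theorem coe_toCircle_two_pi (x : ℝ) :
    ((AddCircle.toCircle (x : AddCircle (2 * Real.pi)) : Circle) : ℂ)
      = Complex.exp (x * Complex.I) := by
  rw [AddCircle.toCircle_apply_mk, Circle.coe_exp]
  have : 2 * Real.pi / (2 * Real.pi) = 1 := div_self Real.two_pi_pos.ne'
  rw [this, one_mul]

theorem expCosCircle_coe (w : ℂ) (x : ℝ) :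
    expCosCircle w (x : AddCircle (2 * Real.pi)) = Complex.exp (w * (Real.cos x : ℝ)) := by
  change Complex.exp (w * (((AddCircle.toCircle (x : AddCircle (2 * Real.pi)) : ℂ).re : ℝ) : ℂ)) = _
  rw [coe_toCircle_two_pi, Complex.exp_ofReal_mul_I_re]

theorem fourierCoeff_expCosCircle (w : ℂ) (k : ℤ) :
    fourierCoeff (expCosCircle w) k = (2 * Real.pi * Complex.I)⁻¹ *
      ∮ z in C(0, 1), z ^ (-k - 1) * Complex.exp (w * ((z + z⁻¹) / 2)) := by
  rw [fourierCoeff_eq_intervalIntegral _ _ 0, zero_add, circleIntegral, mul_inv, mul_assoc,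
    ← intervalIntegral.integral_const_mul, Complex.real_smul]
  push_cast
  rw [one_div]
  congr 1
  refine intervalIntegral.integral_congr fun x _ => ?_
  have hne : Complex.exp (x * Complex.I) ≠ 0 := Complex.exp_ne_zero _
  simp only [deriv_circleMap, circleMap, zero_add, Complex.ofReal_one, one_mul, smul_eq_mul]
  rw [expCosCircle_coe, fourier_coe_apply, zpow_sub_one₀ hne, ← Complex.exp_int_mul,
    ← Complex.exp_neg (x * Complex.I), Complex.ofReal_cos, Complex.cos, ← neg_mul]
  have h1 : 2 * (Real.pi : ℂ) * Complex.I * ((-k : ℤ) : ℂ) * x / ((2 * Real.pi : ℝ) : ℂ)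
      = ((-k : ℤ) : ℂ) * (x * Complex.I) := by
    have hpi : (Real.pi : ℂ) ≠ 0 := by exact_mod_cast Real.pi_ne_zero
    push_cast
    field_simp
  have h2 : Complex.exp (x * Complex.I) * Complex.exp (-x * Complex.I) = 1 := by
    rw [← Complex.exp_add, neg_mul, add_neg_cancel, Complex.exp_zero]
  rw [h1]
  set a := Complex.exp (x * Complex.I)
  set b := Complex.exp (-x * Complex.I)
  set E := Complex.exp (((-k : ℤ) : ℂ) * (x * Complex.I))
  set G := Complex.exp (w * ((a + b) / 2))
  calc E * G = (Complex.I⁻¹ * Complex.I) * (a * b) * (E * G) := by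
        rw [inv_mul_cancel₀ Complex.I_ne_zero, h2, one_mul, one_mul]
    _ = _ := by ring

theorem norm_fourierCoeff_expCosCircle_le (w : ℂ) (k : ℤ) {r : ℝ} (hr : 0 < r) :
    ‖fourierCoeff (expCosCircle w) k‖
      ≤ Real.exp (|w.re| * ((r + r⁻¹) / 2) + |w.im| * (|r - r⁻¹| / 2)) * r ^ (-k) := by
  rw [fourierCoeff_expCosCircle, circleIntegral_zpow_mul_exp_joukowski w k one_pos hr]
  have h := circleIntegral.norm_two_pi_i_inv_smul_integral_le_of_norm_le_const (c := 0)
    (f := fun z => z ^ (-k - 1) * Complex.exp (w * ((z + z⁻¹) / 2))) hr.le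
    (C := r ^ (-k - 1) *
      Real.exp (|w.re| * ((r + r⁻¹) / 2) + |w.im| * (|r - r⁻¹| / 2))) (by
    intro z hz
    have hz' : ‖z‖ = r := by simpa using hz
    rw [norm_mul, norm_zpow, hz']
    exact mul_le_mul_of_nonneg_left (norm_exp_mul_joukowski_le w hr hz') (by positivity))
  rw [smul_eq_mul] at h
  refine h.trans (le_of_eq ?_)
  rw [← mul_assoc, zpow_sub_one₀ hr.ne', mul_comm (r ^ (-k)), ← mul_assoc, mul_inv_cancel₀ hr.ne']
  ring

theorem norm_fourierCoeff_expCosCircle_le_natAbs (w : ℂ) (k : ℤ) {ϱ : ℝ} (hϱ : 1 < ϱ) :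
    ‖fourierCoeff (expCosCircle w) k‖
      ≤ Real.exp (|w.re| * ((ϱ + ϱ⁻¹) / 2) + |w.im| * ((ϱ - ϱ⁻¹) / 2)) * ϱ⁻¹ ^ k.natAbs := by
  have h0 : 0 < ϱ := by linarith
  have hinv : ϱ⁻¹ ≤ 1 := inv_le_one_of_one_le₀ hϱ.le
  have habs : |ϱ - ϱ⁻¹| = ϱ - ϱ⁻¹ := abs_of_nonneg (by linarith)
  rcases le_total 0 k with hk | hk
  · have h := norm_fourierCoeff_expCosCircle_le w k h0
    rw [habs] at h
    convert h using 2
    rw [← zpow_natCast, Int.natCast_natAbs, abs_of_nonneg hk, inv_zpow']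
  · have h := norm_fourierCoeff_expCosCircle_le w k (inv_pos.2 h0)
    rw [inv_inv, abs_sub_comm, habs, add_comm ϱ⁻¹ ϱ] at h
    convert h using 2
    rw [← zpow_natCast, Int.natCast_natAbs, abs_of_nonpos hk]

theorem summable_pow_natAbs {q : ℝ} (h0 : 0 ≤ q) (h1 : q < 1) :
    Summable fun k : ℤ => q ^ k.natAbs := by
  refine Summable.of_nat_of_neg ?_ ?_ <;> simpa using summable_geometric_of_lt_one h0 h1

/-- The Chebyshev expansion of `x ↦ exp (w x)` on `[-1,1]`, as a series over `ℤ`. Averaging the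
Fourier series of `exp (w cos t)` over `t` and `-t` turns `exp (i k t)` into `cos (k t)`. -/
theorem hasSum_chebyshev_exp (w : ℂ) {x : ℝ} (hx : |x| ≤ 1) :
    HasSum (fun k : ℤ => fourierCoeff (expCosCircle w) k *
      (((Polynomial.Chebyshev.T ℝ k).eval x : ℝ) : ℂ)) (Complex.exp (w * x)) := by
  have hsum : Summable (fourierCoeff (expCosCircle w)) := by
    refine Summable.of_norm_bounded ?_
      (fun k => norm_fourierCoeff_expCosCircle_le_natAbs w k one_lt_two)
    exact (summable_pow_natAbs (by norm_num) (by norm_num)).mul_left _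
  obtain ⟨t, rfl⟩ : ∃ t, x = Real.cos t :=
    ⟨Real.arccos x, (Real.cos_arccos (abs_le.1 hx).1 (abs_le.1 hx).2).symm⟩
  have h1 := has_pointwise_sum_fourier_series_of_summable hsum (t : AddCircle (2 * Real.pi))
  have h2 := has_pointwise_sum_fourier_series_of_summable hsum ((-t : ℝ) : AddCircle (2 * Real.pi))
  rw [expCosCircle_coe] at h1 h2
  rw [Real.cos_neg] at h2
  have h3 := (h1.add h2).div_const 2
  rw [add_self_div_two] at h3
  refine h3.congr_fun fun k => ?_
  rw [Polynomial.Chebyshev.T_real_cos, fourier_coe_apply, fourier_coe_apply, smul_eq_mul,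
    smul_eq_mul, ← mul_add, mul_div_assoc]
  congr 1
  have hpi : (Real.pi : ℂ) ≠ 0 := by exact_mod_cast Real.pi_ne_zero
  rw [Complex.ofReal_cos, Complex.cos]
  congr 3 <;> · push_cast; field_simp

/-- The tail of the Chebyshev expansion of `exp (w x)` dominates its interpolation error, since
`T_k` with `k ≤ n` is reproduced. The cardinal functions are only bounded by a constant, so
that the interpolation operator has norm `O(n)`; this factor and the summation over the tail are
paid for by reducing the rate from `τ ^ 4` to `τ`. -/
theorem exists_norm_exp_sub_interp_le {τ : ℝ} (hτ : 1 < τ) :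
    ∃ C > (0 : ℝ), ∀ n : ℕ, 1 ≤ n → ∀ (w : ℂ) (x : ℝ), |x| ≤ 1 →
      ‖Complex.exp (w * x) - ∑ k : Fin (n + 1),
        Complex.exp (w * (Real.cos (Real.pi * ((k : ℕ) : ℝ) / n) : ℝ)) * (chebCardinal n k x : ℝ)‖
      ≤ C * Real.exp (|w.re| * ((τ ^ 4 + (τ ^ 4)⁻¹) / 2) + |w.im| * ((τ ^ 4 - (τ ^ 4)⁻¹) / 2))
          * τ⁻¹ ^ n := by
  have hτ0 : 0 < τ := by linarith
  have hq0 : 0 < τ⁻¹ := inv_pos.2 hτ0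
  have hq1 : τ⁻¹ < 1 := inv_lt_one_of_one_lt₀ hτ
  have hS := summable_pow_natAbs hq0.le hq1
  have hSpos : 0 < ∑' k : ℤ, τ⁻¹ ^ k.natAbs := hS.tsum_pos (fun k => by positivity) 0 (by simp)
  refine ⟨(4 / (τ - 1) + 5) * ∑' k : ℤ, τ⁻¹ ^ k.natAbs, ?_, ?_⟩
  · have : 0 < τ - 1 := by linarith
    positivity
  intro n hn w x hx
  set M := Real.exp (|w.re| * ((τ ^ 4 + (τ ^ 4)⁻¹) / 2) + |w.im| * ((τ ^ 4 - (τ ^ 4)⁻¹) / 2))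
    with hM
  set ζ : Fin (n + 1) → ℝ := fun k => Real.cos (Real.pi * ((k : ℕ) : ℝ) / n) with hζ
  set a : ℤ → ℂ := fun k => fourierCoeff (expCosCircle w) k with ha
  set T : ℤ → ℝ → ℝ := fun k x => (Polynomial.Chebyshev.T ℝ k).eval x with hT
  set e : ℤ → ℝ := fun k => T k x - ∑ j, T k (ζ j) * chebCardinal n j x with he
  have hζ1 : ∀ j, |ζ j| ≤ 1 := fun j => Real.abs_cos_le_one _
  have hsum : HasSum (fun k => a k * (e k : ℝ)) (Complex.exp (w * x) - ∑ k : Fin (n + 1),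
      Complex.exp (w * (ζ k : ℝ)) * (chebCardinal n k x : ℝ)) := by
    have h1 := (hasSum_chebyshev_exp w hx).sub (hasSum_sum (s := Finset.univ) fun j _ =>
      (hasSum_chebyshev_exp w (hζ1 j)).mul_right ((chebCardinal n j x : ℝ) : ℂ))
    refine h1.congr_fun fun k => ?_
    simp only [he, ha, hT]
    push_cast
    rw [mul_sub, Finset.mul_sum]
    congr 1
    exact Finset.sum_congr rfl fun j _ => by ring
  -- the polynomials of degree at most `n` are reproduced
  have he0 : ∀ k : ℤ, k.natAbs ≤ n → e k = 0 := by
    intro k hk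
    have h := sum_T_mul_chebCardinal hn hk x
    rw [Polynomial.Chebyshev.T_natAbs] at h
    simp only [he, hT, hζ]
    rw [h, sub_self]
  have he1 : ∀ k : ℤ, |e k| ≤ 4 * n + 5 := by
    intro k
    have h1 : |T k x| ≤ 1 := Polynomial.Chebyshev.abs_eval_T_real_le_one k hx
    have h2 : |∑ j, T k (ζ j) * chebCardinal n j x| ≤ ∑ _j : Fin (n + 1), (1 : ℝ) * 4 := by
      refine (Finset.abs_sum_le_sum_abs _ _).trans (Finset.sum_le_sum fun j _ => ?_)
      rw [abs_mul]
      exact mul_le_mul (Polynomial.Chebyshev.abs_eval_T_real_le_one k (hζ1 j))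
        (abs_chebCardinal_le hn j hx) (abs_nonneg _) zero_le_one
    simp only [Finset.sum_const, Finset.card_univ, Fintype.card_fin, nsmul_eq_mul] at h2
    push_cast at h2
    have h3 := abs_sub (T k x) (∑ j, T k (ζ j) * chebCardinal n j x)
    simp only [he]
    linarith
  have hn_le : (4 * n + 5) * τ⁻¹ ^ n ≤ 4 / (τ - 1) + 5 := by
    have hb : 1 + (n : ℝ) * (τ - 1) ≤ τ ^ n := by
      have := one_add_mul_le_pow (a := τ - 1) (by linarith) n
      simpa using this
    have hp : 0 < τ ^ n := by positivity
    have hτ1 : 0 < τ - 1 := by linarith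
    have h1 : (n : ℝ) ≤ τ ^ n / (τ - 1) := by
      rw [le_div_iff₀ hτ1]
      linarith
    have h2 : 1 ≤ τ ^ n := one_le_pow₀ hτ.le
    rw [inv_pow, ← div_eq_mul_inv, div_le_iff₀ hp]
    calc 4 * (n : ℝ) + 5 ≤ 4 * (τ ^ n / (τ - 1)) + 5 * τ ^ n := by linarith
      _ = _ := by ring
  have hterm : ∀ k : ℤ, ‖a k * (e k : ℝ)‖
      ≤ M * (4 / (τ - 1) + 5) * τ⁻¹ ^ n * τ⁻¹ ^ k.natAbs := by
    intro k
    have hnn : 0 ≤ 4 / (τ - 1) + 5 := le_trans (by positivity) hn_le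
    by_cases hk : k.natAbs ≤ n
    · rw [he0 k hk]
      simp only [Complex.ofReal_zero, mul_zero, norm_zero]
      positivity
    · have h1 : ‖a k‖ ≤ M * (τ ^ 4)⁻¹ ^ k.natAbs :=
        norm_fourierCoeff_expCosCircle_le_natAbs w k (one_lt_pow₀ hτ (by norm_num))
      have h2 : (τ ^ 4)⁻¹ ^ k.natAbs ≤ τ⁻¹ ^ n * τ⁻¹ ^ n * τ⁻¹ ^ k.natAbs := by
        rw [← inv_pow, ← pow_mul, ← pow_add, ← pow_add]
        exact pow_le_pow_of_le_one hq0.le hq1.le (by omega)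
      rw [norm_mul, Complex.norm_real, Real.norm_eq_abs]
      calc ‖a k‖ * |e k| ≤ (M * (τ⁻¹ ^ n * τ⁻¹ ^ n * τ⁻¹ ^ k.natAbs)) * (4 * n + 5) :=
            mul_le_mul (h1.trans (by gcongr)) (he1 k) (abs_nonneg _) (by positivity)
        _ = M * ((4 * n + 5) * τ⁻¹ ^ n) * τ⁻¹ ^ n * τ⁻¹ ^ k.natAbs := by ring
        _ ≤ _ := by gcongr
  rw [← hsum.tsum_eq]
  refine (tsum_of_norm_bounded (hS.hasSum.mul_left _) hterm).trans (le_of_eq ?_)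
  ring

/-! ### Tensor products -/

theorem norm_prod_sub_prod_le {ι : Type*} (s : Finset ι) (a b : ι → ℂ) (m : ι → ℝ) {K δ : ℝ}
    (hK : 1 ≤ K) (hδ : 0 ≤ δ) (hm : ∀ i, 0 ≤ m i) (ha : ∀ i, ‖a i‖ ≤ m i)
    (hb : ∀ i, ‖b i‖ ≤ K * m i) (hab : ∀ i, ‖a i - b i‖ ≤ δ * m i) :
    ‖∏ i ∈ s, a i - ∏ i ∈ s, b i‖ ≤ s.card * K ^ s.card * δ * ∏ i ∈ s, m i := by
  classical
  induction s using Finset.induction_on with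
  | empty => simp
  | insert i s hi ih =>
    rw [Finset.prod_insert hi, Finset.prod_insert hi, Finset.prod_insert hi,
      Finset.card_insert_of_notMem hi]
    set A := ∏ i ∈ s, a i
    set B := ∏ i ∈ s, b i with hB
    set M := ∏ i ∈ s, m i with hM
    have hM0 : 0 ≤ M := Finset.prod_nonneg fun i _ => hm i
    have hBM : ‖B‖ ≤ K ^ s.card * M := by
      rw [hB, norm_prod, hM, ← Finset.prod_const, ← Finset.prod_mul_distrib]
      exact Finset.prod_le_prod (fun i _ => norm_nonneg _) fun i _ => hb i
    have hKs : K ^ s.card ≤ K ^ (s.card + 1) := pow_le_pow_right₀ hK (Nat.le_succ _)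
    have hmi := hm i
    calc ‖a i * A - b i * B‖ = ‖a i * (A - B) + (a i - b i) * B‖ := by congr 1; ring
      _ ≤ ‖a i‖ * ‖A - B‖ + ‖a i - b i‖ * ‖B‖ := by
          rw [← norm_mul, ← norm_mul]
          exact norm_add_le _ _
      _ ≤ m i * (s.card * K ^ s.card * δ * M) + δ * m i * (K ^ s.card * M) := by
          gcongr
          · exact ha i
          · exact hab i
      _ = ((s.card + 1 : ℕ) : ℝ) * δ * m i * M * K ^ s.card := by push_cast; ring
      _ ≤ ((s.card + 1 : ℕ) : ℝ) * δ * m i * M * K ^ (s.card + 1) := by gcongr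
      _ = _ := by ring

/-- The interpolation error of a tensor-product exponential `s ↦ ∏ exp (w_j x_j)`. Interpolation
of a product function is the product of the one-dimensional interpolations, so that the
one-dimensional bound suffices. -/
theorem exists_norm_exp_sum_sub_interp_le (D : ℕ) {τ : ℝ} (hτ : 1 < τ) :
    ∃ C > (0 : ℝ), ∀ n : ℕ, 1 ≤ n → ∀ (w : Fin D → ℂ) (x : Fin D → ℝ), (∀ i, |x i| ≤ 1) →
      ‖Complex.exp (∑ i, w i * x i) - ∑ k : Fin D → Fin (n + 1),
        Complex.exp (∑ i, w i * (chebNode n k i : ℝ)) * (∏ i, chebCardinal n (k i) (x i) : ℝ)‖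
      ≤ C * Real.exp (∑ i, (|(w i).re| * ((τ ^ 4 + (τ ^ 4)⁻¹) / 2)
            + |(w i).im| * ((τ ^ 4 - (τ ^ 4)⁻¹) / 2))) * τ⁻¹ ^ n := by
  obtain ⟨C, hC, h⟩ := exists_norm_exp_sub_interp_le hτ
  refine ⟨(D + 1) * (1 + C) ^ D * C, by positivity, fun n hn w x hx => ?_⟩
  have hτ4 : 1 < τ ^ 4 := one_lt_pow₀ hτ (by norm_num)
  have hinv : (τ ^ 4)⁻¹ ≤ 1 := inv_le_one_of_one_le₀ hτ4.le
  have hq : τ⁻¹ ^ n ≤ 1 := pow_le_one₀ (by positivity) (inv_le_one_of_one_le₀ hτ.le)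
  have hτ0 : 0 < τ := by linarith
  set A := (τ ^ 4 + (τ ^ 4)⁻¹) / 2 with hA
  set B := (τ ^ 4 - (τ ^ 4)⁻¹) / 2 with hB
  have hA1 : 1 ≤ A := by
    have h2 : τ ^ 4 * (τ ^ 4)⁻¹ = 1 := mul_inv_cancel₀ (by positivity)
    rw [hA]
    nlinarith [sq_nonneg (τ ^ 4 - 1)]
  have hB0 : 0 ≤ B := by rw [hB]; linarith
  have hprod : ∑ k : Fin D → Fin (n + 1),
        Complex.exp (∑ i, w i * (chebNode n k i : ℝ)) * (∏ i, chebCardinal n (k i) (x i) : ℝ)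
      = ∏ i, ∑ k : Fin (n + 1), Complex.exp (w i * (Real.cos (Real.pi * ((k : ℕ) : ℝ) / n) : ℝ)) *
          (chebCardinal n k (x i) : ℝ) := by
    rw [Finset.prod_univ_sum, Fintype.piFinset_univ]
    refine Finset.sum_congr rfl fun k _ => ?_
    rw [Complex.exp_sum, Finset.prod_mul_distrib, Complex.ofReal_prod]
    rfl
  rw [hprod, Complex.exp_sum, Real.exp_sum]
  set m : Fin D → ℝ := fun i => Real.exp (|(w i).re| * A + |(w i).im| * B) with hm
  have herr : ∀ i, ‖Complex.exp (w i * x i) - ∑ k : Fin (n + 1),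
      Complex.exp (w i * (Real.cos (Real.pi * ((k : ℕ) : ℝ) / n) : ℝ)) *
        (chebCardinal n k (x i) : ℝ)‖ ≤ C * τ⁻¹ ^ n * m i := by
    intro i
    refine (h n hn (w i) (x i) (hx i)).trans (le_of_eq ?_)
    ring
  have ha : ∀ i, ‖Complex.exp (w i * x i)‖ ≤ m i := by
    intro i
    rw [Complex.norm_exp]
    apply Real.exp_le_exp.2
    rw [Complex.re_mul_ofReal]
    have h1 : (w i).re * x i ≤ |(w i).re| * 1 := by
      refine (le_abs_self _).trans ?_
      rw [abs_mul]
      exact mul_le_mul_of_nonneg_left (hx i) (abs_nonneg _)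
    have h2 : |(w i).re| * 1 ≤ |(w i).re| * A := mul_le_mul_of_nonneg_left hA1 (abs_nonneg _)
    have h3 : 0 ≤ |(w i).im| * B := by positivity
    linarith
  have hCq : C * τ⁻¹ ^ n ≤ C := mul_le_of_le_one_right hC.le hq
  have hfin := norm_prod_sub_prod_le Finset.univ (fun i => Complex.exp (w i * x i))
    (fun i => ∑ k : Fin (n + 1),
      Complex.exp (w i * (Real.cos (Real.pi * ((k : ℕ) : ℝ) / n) : ℝ)) *
        (chebCardinal n k (x i) : ℝ)) m (K := 1 + C) (δ := C * τ⁻¹ ^ n)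
    (by linarith) (by positivity) (fun i => (Real.exp_pos _).le) ha
    (fun i => by
      have h1 := norm_le_norm_add_norm_sub' (∑ k : Fin (n + 1),
        Complex.exp (w i * (Real.cos (Real.pi * ((k : ℕ) : ℝ) / n) : ℝ)) *
          (chebCardinal n k (x i) : ℝ)) (Complex.exp (w i * x i))
      rw [norm_sub_rev] at h1
      have h2 : C * τ⁻¹ ^ n * m i ≤ C * m i :=
        mul_le_mul_of_nonneg_right hCq (Real.exp_pos _).le
      have h3 := herr i
      have h4 := ha i
      linarith) herr
  refine hfin.trans ?_
  have hm0 : 0 ≤ ∏ i, m i := Finset.prod_nonneg fun i _ => (Real.exp_pos _).le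
  simp only [Finset.card_univ, Fintype.card_fin]
  calc (D : ℝ) * (1 + C) ^ D * (C * τ⁻¹ ^ n) * ∏ i, m i
      ≤ (D + 1) * (1 + C) ^ D * (C * τ⁻¹ ^ n) * ∏ i, m i := by gcongr; linarith
    _ = _ := by ring

/-! ### Exponential moments of `exp (-c ‖y‖ ^ α)` -/

/-- Young's inequality with a prescribed coefficient of `t ^ α`. -/
theorem exists_mul_le_rpow_add_rpow {α c : ℝ} (hα : 1 < α) (hc : 0 < c) :
    ∃ C > (0 : ℝ), ∀ x t : ℝ, 0 ≤ x → 0 ≤ t → x * t ≤ c * t ^ α + C * x ^ (α / (α - 1)) := by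
  have hα0 : 0 < α := by linarith
  have hα1 : 0 < α - 1 := by linarith
  set η := c ^ (1 / α) with hη
  have hη0 : 0 < η := Real.rpow_pos_of_pos hc _
  have hηα : η ^ α = c := by
    rw [hη, ← Real.rpow_mul hc.le, one_div_mul_cancel hα0.ne', Real.rpow_one]
  have hconj : α.HolderConjugate (α / (α - 1)) := Real.HolderConjugate.conjExponent hα
  refine ⟨(η ^ (α / (α - 1)))⁻¹, by positivity, fun x t hx ht => ?_⟩
  have h := Real.young_inequality_of_nonneg (mul_nonneg hη0.le ht) (div_nonneg hx hη0.le) hconj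
  rw [Real.mul_rpow hη0.le ht, hηα, Real.div_rpow hx hη0.le] at h
  have h1 : c * t ^ α / α ≤ c * t ^ α := div_le_self (by positivity) hα.le
  have hϑ : 1 ≤ α / (α - 1) := by rw [le_div_iff₀ hα1]; linarith
  have h2 : x ^ (α / (α - 1)) / η ^ (α / (α - 1)) / (α / (α - 1))
      ≤ x ^ (α / (α - 1)) / η ^ (α / (α - 1)) := div_le_self (by positivity) hϑ
  calc x * t = η * t * (x / η) := by field_simp
    _ ≤ _ := h
    _ ≤ c * t ^ α + x ^ (α / (α - 1)) / η ^ (α / (α - 1)) := add_le_add h1 h2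
    _ = _ := by ring

theorem integrable_exp_neg_norm (D : ℕ) :
    Integrable (fun y : RVec D => Real.exp (-‖y‖)) := by
  have h := (integrable_one_add_norm (E := RVec D) (μ := volume) (r := (D + 1 : ℕ))
    (by simp)).const_mul (((D + 1).factorial : ℝ) * Real.exp 1)
  refine h.mono' (by fun_prop) (Filter.Eventually.of_forall fun y => ?_)
  have h1 := Real.pow_div_factorial_le_exp (1 + ‖y‖) (by positivity) (D + 1)
  rw [Real.norm_eq_abs, abs_of_pos (Real.exp_pos _), Real.rpow_neg (by positivity),
    Real.rpow_natCast, Real.exp_neg, ← div_eq_mul_inv, le_div_iff₀ (by positivity),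
    inv_mul_le_iff₀ (Real.exp_pos _)]
  rw [div_le_iff₀ (by positivity), Real.exp_add] at h1
  linarith

/-- Exponential moments of the weight `exp (-c ‖y‖ ^ α)` grow like `exp (C t ^ ϑ)` with the
conjugate exponent `ϑ = α / (α - 1)`. -/
theorem exists_integral_exp_neg_rpow_add_le (D : ℕ) {α c : ℝ} (hα : 1 < α) (hc : 0 < c) :
    ∃ K > (0 : ℝ), ∃ C > (0 : ℝ), ∀ t : ℝ, 0 ≤ t →
      Integrable (fun y : RVec D => Real.exp (-(c * ‖y‖ ^ α) + t * ‖y‖)) ∧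
      ∫ y : RVec D, Real.exp (-(c * ‖y‖ ^ α) + t * ‖y‖)
        ≤ K * Real.exp (C * t ^ (α / (α - 1))) := by
  obtain ⟨C, hC, hY⟩ := exists_mul_le_rpow_add_rpow hα hc
  set ϑ := α / (α - 1) with hϑ
  have hα1 : 0 < α - 1 := by linarith
  have hϑ1 : 1 ≤ ϑ := by rw [hϑ, le_div_iff₀ hα1]; linarith
  set J := ∫ y : RVec D, Real.exp (-‖y‖) with hJ
  have hJ0 : 0 ≤ J := integral_nonneg fun y => (Real.exp_pos _).le
  have hbound : ∀ t : ℝ, 0 ≤ t → ∀ y : RVec D, Real.exp (-(c * ‖y‖ ^ α) + t * ‖y‖)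
      ≤ Real.exp (C * 2 ^ (ϑ - 1)) * Real.exp (C * 2 ^ (ϑ - 1) * t ^ ϑ) * Real.exp (-‖y‖) := by
    intro t ht y
    rw [← Real.exp_add, ← Real.exp_add]
    apply Real.exp_le_exp.2
    have h1 := hY (t + 1) ‖y‖ (by linarith) (norm_nonneg _)
    have h2 : (t + 1) ^ ϑ ≤ 2 ^ (ϑ - 1) * (t ^ ϑ + 1) := by
      have h := NNReal.rpow_add_le_mul_rpow_add_rpow ⟨t, ht⟩ 1 hϑ1
      rw [NNReal.one_rpow] at h
      exact_mod_cast h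
    have h3 := mul_le_mul_of_nonneg_left h2 hC.le
    nlinarith
  have hint : ∀ t : ℝ, 0 ≤ t →
      Integrable (fun y : RVec D => Real.exp (-(c * ‖y‖ ^ α) + t * ‖y‖)) := by
    intro t ht
    refine ((integrable_exp_neg_norm D).const_mul
      (Real.exp (C * 2 ^ (ϑ - 1)) * Real.exp (C * 2 ^ (ϑ - 1) * t ^ ϑ))).mono' ?_
      (Filter.Eventually.of_forall fun y => ?_)
    · have : 0 ≤ α := by linarith
      exact (by fun_prop (disch := assumption) :
        Measurable fun y : RVec D => Real.exp (-(c * ‖y‖ ^ α) + t * ‖y‖)).aestronglyMeasurable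
    · rw [Real.norm_eq_abs, abs_of_pos (Real.exp_pos _)]
      exact hbound t ht y
  refine ⟨Real.exp (C * 2 ^ (ϑ - 1)) * (J + 1), by positivity, C * 2 ^ (ϑ - 1), by positivity,
    fun t ht => ⟨hint t ht, ?_⟩⟩
  calc ∫ y : RVec D, Real.exp (-(c * ‖y‖ ^ α) + t * ‖y‖)
      ≤ ∫ y : RVec D, Real.exp (C * 2 ^ (ϑ - 1)) * Real.exp (C * 2 ^ (ϑ - 1) * t ^ ϑ) *
          Real.exp (-‖y‖) :=
        integral_mono (hint t ht) ((integrable_exp_neg_norm D).const_mul _) (hbound t ht)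
    _ = Real.exp (C * 2 ^ (ϑ - 1)) * Real.exp (C * 2 ^ (ϑ - 1) * t ^ ϑ) * J :=
        integral_const_mul _ _
    _ ≤ Real.exp (C * 2 ^ (ϑ - 1)) * Real.exp (C * 2 ^ (ϑ - 1) * t ^ ϑ) * (J + 1) := by
        gcongr; linarith
    _ = _ := by ring

/-! ### Fourier inversion for finite measures -/

section FourierInversion

open FourierTransform

variable {E : Type*} [NormedAddCommGroup E] [InnerProductSpace ℝ E] [MeasurableSpace E]

/-- The Fourier transform of a measure in the normalization of `𝓕`. -/
noncomputable def fourierMeasure (ν : Measure E) (v : E) : ℂ := charFun ν (-(2 * Real.pi) • v)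

theorem fourierMeasure_eq_fourierIntegral (ν : Measure E) (v : E) :
    fourierMeasure ν v
      = VectorFourier.fourierIntegral Real.fourierChar ν (innerₗ E) (fun _ => (1 : ℂ)) v := by
  rw [fourierMeasure, charFun_eq_fourierIntegral', smul_smul]
  have : -(2 * Real.pi)⁻¹ * -(2 * Real.pi) = 1 := by
    rw [neg_mul_neg, inv_mul_cancel₀ Real.two_pi_pos.ne']
  rw [this, one_smul]
  rfl

variable [FiniteDimensional ℝ E] [BorelSpace E]

/-- The inverse Fourier transform of `fourierMeasure ν`; the density of a measure with integrable characteristic function. -/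
noncomputable def fourierDensity (ν : Measure E) (x : E) : ℂ := 𝓕⁻ (fourierMeasure ν) x

theorem integrable_fourierMeasure {ν : Measure E} (hν : Integrable (charFun ν)) :
    Integrable (fourierMeasure ν) :=
  hν.comp_smul (by simp [Real.pi_ne_zero])

theorem integral_fourierInv_mul_eq {f g : E → ℂ} (hf : Integrable f) (hg : Integrable g) :
    ∫ x, 𝓕⁻ f x * g x = ∫ x, f x * 𝓕⁻ g x := by
  have h := VectorFourier.integral_fourierIntegral_smul_eq_flip (L := -innerₗ E) (μ := volume)
    (ν := volume) Real.continuous_fourierChar (by simpa using! continuous_inner.neg) hf hg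
  have hflip : (-innerₗ E).flip = -innerₗ E := by
    ext x y
    simp [real_inner_comm]
  simp only [smul_eq_mul, hflip] at h
  exact h

theorem continuous_fourierInv {f : E → ℂ} (hf : Integrable f) : Continuous (𝓕⁻ f) :=
  VectorFourier.fourierIntegral_continuous (L := -innerₗ E) Real.continuous_fourierChar
    (by simpa using! continuous_inner.neg) hf

theorem norm_fourierInv_le (f : E → ℂ) (x : E) : ‖𝓕⁻ f x‖ ≤ ∫ v, ‖f v‖ :=
  VectorFourier.norm_fourierIntegral_le_integral_norm _ _ _ _ _

variable {ν : Measure E} [IsFiniteMeasure ν]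

/-- Parseval's identity, tested against Schwartz functions. -/
theorem integral_schwartz_eq (hν : Integrable (charFun ν)) (h : SchwartzMap E ℂ) :
    ∫ x, h x ∂ν = ∫ x, h x * fourierDensity ν x := by
  have hinv : 𝓕 (𝓕⁻ h) = h := FourierTransform.fourier_fourierInv_eq h
  have h1 := VectorFourier.integral_fourierIntegral_smul_eq_flip (L := innerₗ E) (μ := volume)
    (ν := ν) (f := (𝓕⁻ h : SchwartzMap E ℂ)) (g := fun _ => (1 : ℂ)) Real.continuous_fourierChar
    continuous_inner (𝓕⁻ h : SchwartzMap E ℂ).integrable (integrable_const _)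
  have h2 : ∀ x, VectorFourier.fourierIntegral Real.fourierChar volume (innerₗ E)
      (𝓕⁻ h : SchwartzMap E ℂ) x = h x := by
    intro x
    conv_rhs => rw [← hinv]
    rw [SchwartzMap.fourier_coe]
    rfl
  simp only [h2, smul_eq_mul, mul_one, flip_innerₗ, ← fourierMeasure_eq_fourierIntegral] at h1
  rw [h1, SchwartzMap.fourierInv_coe]
  exact integral_fourierInv_mul_eq h.integrable (integrable_fourierMeasure hν)

/-- A finite measure with integrable characteristic function has the density `fourierDensity`.
Both sides are compared through their densities with respect to the dominating measure
`ν + volume`. -/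
theorem rnDeriv_ae_eq_fourierDensity (hν : Integrable (charFun ν)) :
    ∀ᵐ x ∂(ν + volume), (((ν.rnDeriv (ν + volume) x).toReal : ℝ) : ℂ)
      = ((volume : Measure E).rnDeriv (ν + volume) x).toReal • fourierDensity ν x := by
  have hν1 : ν ≤ ν + volume := Measure.le_add_right le_rfl
  have hv1 : (volume : Measure E) ≤ ν + volume := Measure.le_add_left le_rfl
  have hφ := integrable_fourierMeasure hν
  have hq : Continuous (fourierDensity ν) := continuous_fourierInv hφ
  have : IsLocallyFiniteMeasure (ν + (volume : Measure E)) := ⟨fun x => by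
    obtain ⟨t, ht, hfin⟩ := (volume : Measure E).finiteAt_nhds x
    exact ⟨t, ht, by
      rw [Measure.add_apply]
      exact ENNReal.add_lt_top.2 ⟨measure_lt_top ν t, hfin⟩⟩⟩
  refine ae_eq_of_integral_contDiff_smul_eq (μ := ν + volume)
    (Measure.integrable_toReal_rnDeriv.ofReal.locallyIntegrable) ?_ ?_
  · refine (locallyIntegrable_const (∫ v, ‖fourierMeasure ν v‖)).mono ?_ ?_
    · exact (Measure.measurable_rnDeriv _ _).ennreal_toReal.aestronglyMeasurable.smul
        hq.aestronglyMeasurable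
    · filter_upwards [Measure.rnDeriv_le_one_of_le hv1] with x hx
      have h1 : ((volume : Measure E).rnDeriv (ν + volume) x).toReal ≤ 1 :=
        ENNReal.toReal_le_of_le_ofReal zero_le_one (by simpa using hx)
      have h2 : ‖fourierDensity ν x‖ ≤ ∫ v, ‖fourierMeasure ν v‖ := norm_fourierInv_le _ _
      rw [norm_smul, Real.norm_of_nonneg ENNReal.toReal_nonneg]
      exact (mul_le_of_le_one_left (norm_nonneg _) h1).trans (h2.trans (le_abs_self _))
  · intro g hg hgc
    have hs := integral_schwartz_eq hν
      ((hgc.comp_left (g := ((↑) : ℝ → ℂ)) Complex.ofReal_zero).toSchwartzMap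
        (Complex.ofRealCLM.contDiff.comp hg))
    have e1 : ∫ x, g x • (((ν.rnDeriv (ν + volume) x).toReal : ℝ) : ℂ) ∂(ν + volume)
        = ∫ x, ((g x : ℝ) : ℂ) ∂ν := by
      rw [← integral_rnDeriv_smul (Measure.absolutelyContinuous_of_le hν1)]
      congr with x
      simp only [Complex.real_smul]
      ring
    have e2 : ∫ x, g x • (((volume : Measure E).rnDeriv (ν + volume) x).toReal •
          fourierDensity ν x) ∂(ν + volume)
        = ∫ x, ((g x : ℝ) : ℂ) * fourierDensity ν x := by
      rw [← integral_rnDeriv_smul (Measure.absolutelyContinuous_of_le hv1)]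
      congr with x
      simp only [Complex.real_smul]
      ring
    rw [e1, e2]
    exact hs

theorem integral_eq_integral_fourierDensity_mul (hν : Integrable (charFun ν)) (G : E → ℂ) :
    ∫ x, G x ∂ν = ∫ x, fourierDensity ν x * G x := by
  have hν1 : ν ≤ ν + volume := Measure.le_add_right le_rfl
  have hv1 : (volume : Measure E) ≤ ν + volume := Measure.le_add_left le_rfl
  rw [← integral_rnDeriv_smul (Measure.absolutelyContinuous_of_le hν1),
    ← integral_rnDeriv_smul (Measure.absolutelyContinuous_of_le hv1)]
  refine integral_congr_ae ?_
  filter_upwards [rnDeriv_ae_eq_fourierDensity hν] with x hx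
  rw [Complex.real_smul, hx, smul_mul_assoc]

theorem integrable_iff_integrable_fourierDensity_mul (hν : Integrable (charFun ν)) (G : E → ℂ) :
    Integrable G ν ↔ Integrable fun x => fourierDensity ν x * G x := by
  have hν1 : ν ≤ ν + volume := Measure.le_add_right le_rfl
  have hv1 : (volume : Measure E) ≤ ν + volume := Measure.le_add_left le_rfl
  rw [← integrable_rnDeriv_smul_iff (Measure.absolutelyContinuous_of_le hν1),
    ← integrable_rnDeriv_smul_iff (Measure.absolutelyContinuous_of_le hv1)]
  refine integrable_congr ?_
  filter_upwards [rnDeriv_ae_eq_fourierDensity hν] with x hx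
  rw [Complex.real_smul, hx, smul_mul_assoc]

theorem integrable_comp_sub_right (hν : Integrable (charFun ν)) {g : E → ℂ} (hg : Integrable g)
    (s : E) : Integrable (fun x => g (x - s)) ν := by
  rw [integrable_iff_integrable_fourierDensity_mul hν]
  refine (hg.comp_sub_right s).bdd_mul (c := ∫ v, ‖fourierMeasure ν v‖) ?_ ?_
  · exact (continuous_fourierInv (integrable_fourierMeasure hν)).aestronglyMeasurable
  · exact Filter.Eventually.of_forall fun x => norm_fourierInv_le _ _

/-- Fourier representation of the convolution of a measure having integrable characteristic
function with an arbitrary integrable function. -/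
theorem integral_comp_sub_right_eq (hν : Integrable (charFun ν)) {g : E → ℂ} (hg : Integrable g)
    (s : E) : ∫ x, g (x - s) ∂ν = ∫ v, 𝓕⁻ g v * fourierMeasure ν v *
      Complex.exp (2 * Real.pi * Complex.I * (inner ℝ v s : ℝ)) := by
  have hφ := integrable_fourierMeasure hν
  set ψ : E → ℂ := fun v => fourierMeasure ν v *
    Complex.exp (2 * Real.pi * Complex.I * (inner ℝ v s : ℝ)) with hψ
  have hψi : Integrable ψ := by
    refine hφ.mul_bdd (c := 1) (by fun_prop) (Filter.Eventually.of_forall fun v => le_of_eq ?_)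
    rw [show 2 * (Real.pi : ℂ) * Complex.I * (inner ℝ v s : ℝ)
      = ((2 * Real.pi * inner ℝ v s : ℝ) : ℂ) * Complex.I by push_cast; ring]
    exact Complex.norm_exp_ofReal_mul_I _
  have hq : ∀ y, fourierDensity ν (y + s) = 𝓕⁻ ψ y := by
    intro y
    rw [fourierDensity, Real.fourierInv_eq', Real.fourierInv_eq']
    congr with v
    simp only [hψ, smul_eq_mul]
    rw [mul_comm (fourierMeasure ν v), ← mul_assoc, ← Complex.exp_add, inner_add_right]
    congr 2
    push_cast
    ring
  rw [integral_eq_integral_fourierDensity_mul hν,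
    ← integral_add_right_eq_self (μ := (volume : Measure E)) _ s]
  simp only [add_sub_cancel_right, hq]
  rw [integral_fourierInv_mul_eq hψi hg]
  congr with v
  simp only [hψ]
  ring

end FourierInversion

/-! ### Analyticity of superpositions of exponentials -/

section Analytic

variable {E : Type*} [NormedAddCommGroup E] [NormedSpace ℂ E]

/-- The `n`-th power of a continuous linear form as a continuous multilinear form. -/
noncomputable def linearFormPow (n : ℕ) (ℓ : E →L[ℂ] ℂ) :
    ContinuousMultilinearMap ℂ (fun _ : Fin n => E) ℂ :=
  (ContinuousMultilinearMap.mkPiAlgebraFin ℂ n ℂ).compContinuousLinearMap fun _ => ℓ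

theorem continuous_linearFormPow (n : ℕ) :
    Continuous (linearFormPow n : (E →L[ℂ] ℂ) → _) := by
  exact (ContinuousMultilinearMap.compContinuousLinearMapLRight (E := fun _ : Fin n => E)
    (ContinuousMultilinearMap.mkPiAlgebraFin ℂ n ℂ)).cont.comp
      (continuous_pi fun _ => continuous_id)

theorem norm_linearFormPow_le (n : ℕ) (ℓ : E →L[ℂ] ℂ) : ‖linearFormPow n ℓ‖ ≤ ‖ℓ‖ ^ n := by
  refine (ContinuousMultilinearMap.norm_compContinuousLinearMap_le _ _).trans (le_of_eq ?_)
  simp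

theorem linearFormPow_apply (n : ℕ) (ℓ : E →L[ℂ] ℂ) (y : E) :
    linearFormPow n ℓ (fun _ => y) = ℓ y ^ n := by
  simp [linearFormPow]

/-- A superposition `z ↦ ∫ ψ a * exp (ℓ a z)` of exponentials is entire as soon as `ψ` has all
exponential moments with respect to `‖ℓ‖`. Its Taylor series at `z` is obtained by integrating
the exponential series. -/
theorem analyticOnNhd_integral_mul_exp {Y : Type*} [MeasurableSpace Y] {μ : Measure Y}
    {ψ : Y → ℂ} {ℓ : Y → E →L[ℂ] ℂ} (hψ : AEStronglyMeasurable ψ μ)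
    (hℓ : AEStronglyMeasurable ℓ μ)
    (hint : ∀ t : ℝ, Integrable (fun a => ‖ψ a‖ * Real.exp (t * ‖ℓ a‖)) μ) :
    AnalyticOnNhd ℂ (fun z => ∫ a, ψ a * Complex.exp (ℓ a z) ∂μ) Set.univ := by
  intro z _
  set c : Y → ℂ := fun a => ψ a * Complex.exp (ℓ a z) with hc
  have hcm : AEStronglyMeasurable c μ :=
    hψ.mul (Complex.continuous_exp.comp_aestronglyMeasurable
      ((ContinuousLinearMap.apply ℂ ℂ z).continuous.comp_aestronglyMeasurable hℓ))
  have hcn : ∀ a, ‖c a‖ ≤ ‖ψ a‖ * Real.exp (‖z‖ * ‖ℓ a‖) := by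
    intro a
    rw [hc, norm_mul, Complex.norm_exp]
    gcongr
    exact (Complex.re_le_norm _).trans (((ℓ a).le_opNorm z).trans (le_of_eq (mul_comm _ _)))
  have hbound : ∀ a, ‖c a‖ * Real.exp ‖ℓ a‖ ≤ ‖ψ a‖ * Real.exp ((‖z‖ + 1) * ‖ℓ a‖) := by
    intro a
    calc ‖c a‖ * Real.exp ‖ℓ a‖ ≤ ‖ψ a‖ * Real.exp (‖z‖ * ‖ℓ a‖) * Real.exp ‖ℓ a‖ := by
          gcongr; exact hcn a
      _ = _ := by rw [mul_assoc, ← Real.exp_add]; congr 2; ring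
  have hbi : Integrable (fun a => ‖c a‖ * Real.exp ‖ℓ a‖) μ := by
    refine (hint (‖z‖ + 1)).mono' (hcm.norm.mul
      (Real.continuous_exp.comp_aestronglyMeasurable hℓ.norm))
      (Filter.Eventually.of_forall fun a => ?_)
    rw [Real.norm_of_nonneg (by positivity)]
    exact hbound a
  set P : ∀ n : ℕ, Y → ContinuousMultilinearMap ℂ (fun _ : Fin n => E) ℂ :=
    fun n a => (c a / n.factorial) • linearFormPow n (ℓ a) with hP
  have hPn : ∀ n a, ‖P n a‖ ≤ ‖c a‖ * Real.exp ‖ℓ a‖ := by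
    intro n a
    rw [hP, norm_smul, norm_div, Complex.norm_natCast]
    calc ‖c a‖ / n.factorial * ‖linearFormPow n (ℓ a)‖ ≤ ‖c a‖ / n.factorial * ‖ℓ a‖ ^ n := by
          gcongr; exact norm_linearFormPow_le n (ℓ a)
      _ = ‖c a‖ * (‖ℓ a‖ ^ n / n.factorial) := by ring
      _ ≤ _ := by
          gcongr; exact Real.pow_div_factorial_le_exp _ (norm_nonneg _) n
  have hPm : ∀ n, AEStronglyMeasurable (P n) μ := fun n =>
    ((continuous_id.div_const _).comp_aestronglyMeasurable hcm).smul ((continuous_linearFormPow n).comp_aestronglyMeasurable hℓ)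
  have hPi : ∀ n, Integrable (P n) μ := fun n =>
    hbi.mono' (hPm n) (Filter.Eventually.of_forall (hPn n))
  refine ⟨fun n => ∫ a, P n a ∂μ, 1, ?_, one_pos, ?_⟩
  · refine FormalMultilinearSeries.le_radius_of_bound (r := 1) _
      (∫ a, ‖c a‖ * Real.exp ‖ℓ a‖ ∂μ) fun n => ?_
    simp only [NNReal.coe_one, one_pow, mul_one]
    exact norm_integral_le_of_norm_le hbi (Filter.Eventually.of_forall (hPn n))
  · intro y hy
    have hy1 : ‖y‖ ≤ 1 := by
      have h : ‖y‖ₑ < 1 := by simpa [Metric.mem_eball, edist_zero_right] using hy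
      rw [enorm_eq_nnnorm, ENNReal.coe_lt_one_iff] at h
      exact_mod_cast h.le
    have happ : ∀ n, (∫ a, P n a ∂μ) (fun _ => y) = ∫ a, c a * (ℓ a y ^ n / n.factorial) ∂μ := by
      intro n
      rw [ContinuousMultilinearMap.integral_apply (hPi n)]
      congr with a
      simp only [hP, smul_apply, linearFormPow_apply, smul_eq_mul]
      ring
    simp only [happ]
    refine hasSum_integral_of_dominated_convergence
      (fun n a => ‖c a‖ * (‖ℓ a‖ ^ n / n.factorial)) ?_ ?_ ?_ ?_ ?_
    · intro n
      exact hcm.mul ((((ContinuousLinearMap.apply ℂ ℂ y).continuous.pow n).div_const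
        _).comp_aestronglyMeasurable hℓ)
    · refine fun n => Filter.Eventually.of_forall fun a => ?_
      rw [norm_mul, norm_div, norm_pow, Complex.norm_natCast]
      have : ‖ℓ a y‖ ≤ ‖ℓ a‖ :=
        ((ℓ a).le_opNorm y).trans (mul_le_of_le_one_right (norm_nonneg _) hy1)
      gcongr
    · exact Filter.Eventually.of_forall fun a =>
        (Real.summable_pow_div_factorial ‖ℓ a‖).mul_left _
    · refine hbi.congr (Filter.Eventually.of_forall fun a => ?_)
      simp only [tsum_mul_left, Real.exp_eq_exp_ℝ, NormedSpace.exp_eq_tsum_div]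
    · refine Filter.Eventually.of_forall fun a => ?_
      have h := (NormedSpace.expSeries_div_hasSum_exp (ℓ a y)).mul_left (c a)
      rw [← Complex.exp_eq_exp_ℂ] at h
      simp only [map_add, Complex.exp_add, hc] at h ⊢
      rw [← mul_assoc]
      exact h

end Analytic

/-! ### The dampened law and the Fourier representation of the price -/

section Price

open FourierTransform

variable {D : ℕ} {Ω : Type*} [MeasurableSpace Ω] {P : Measure Ω} {X : Ω → RVec D} {R : RVec D}

theorem integral_dampenedLaw (hX : Measurable X) {G : RVec D → ℂ} (hG : StronglyMeasurable G) :
    ∫ x, G x ∂(dampenedLaw P X R) = ∫ ω, Real.exp (inner ℝ R (X ω)) • G (X ω) ∂P := by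
  have hm : Measurable fun x : RVec D => Real.exp (inner ℝ R x) := by fun_prop
  rw [dampenedLaw, integral_withDensity_eq_integral_toReal_smul hm.ennreal_ofReal
    (Filter.Eventually.of_forall fun x => ENNReal.ofReal_lt_top)]
  simp only [ENNReal.toReal_ofReal (Real.exp_pos _).le]
  exact integral_map hX.aemeasurable
    (hm.stronglyMeasurable.smul hG).aestronglyMeasurable

theorem integrable_dampenedLaw_iff (hX : Measurable X) {G : RVec D → ℂ}
    (hG : StronglyMeasurable G) :
    Integrable G (dampenedLaw P X R)
      ↔ Integrable (fun ω => Real.exp (inner ℝ R (X ω)) • G (X ω)) P := by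
  have hm : Measurable fun x : RVec D => Real.exp (inner ℝ R x) := by fun_prop
  rw [dampenedLaw, integrable_withDensity_iff_integrable_smul' hm.ennreal_ofReal
    (Filter.Eventually.of_forall fun x => ENNReal.ofReal_lt_top)]
  simp only [ENNReal.toReal_ofReal (Real.exp_pos _).le]
  exact integrable_map_measure (hm.stronglyMeasurable.smul hG).aestronglyMeasurable
    hX.aemeasurable

theorem isFiniteMeasure_dampenedLaw (hX : Measurable X)
    (hB3 : Integrable (fun ω => Real.exp (inner ℝ R (X ω))) P) :
    IsFiniteMeasure (dampenedLaw P X R) := by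
  have hm : Measurable fun x : RVec D => Real.exp (inner ℝ R x) := by fun_prop
  exact isFiniteMeasure_withDensity_ofReal
    ((integrable_map_measure hm.aestronglyMeasurable hX.aemeasurable).2 hB3).2

theorem charFun_dampenedLaw (hX : Measurable X) (u : RVec D) :
    charFun (dampenedLaw P X R) u
      = complexCharFun P X (fun j => (u j : ℂ) - Complex.I * (R j : ℂ)) := by
  rw [charFun_apply, integral_dampenedLaw hX (by
    exact (by fun_prop : Continuous fun x : RVec D =>
      Complex.exp ((inner ℝ x u : ℝ) * Complex.I)).stronglyMeasurable), complexCharFun]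
  congr with ω
  rw [Complex.real_smul, Complex.ofReal_exp, ← Complex.exp_add]
  congr 1
  simp only [PiLp.inner_apply, RCLike.inner_apply, conj_trivial, Complex.ofReal_sum,
    Complex.ofReal_mul, Finset.mul_sum, Finset.sum_mul]
  rw [← Finset.sum_add_distrib]
  refine Finset.sum_congr rfl fun j _ => ?_
  linear_combination ((X ω j : ℂ) * (R j : ℂ)) * Complex.I_mul_I

theorem ofReal_inner_eq_sum (x y : RVec D) : ((inner ℝ x y : ℝ) : ℂ) = ∑ j, (x j : ℂ) * y j := by
  simp [PiLp.inner_apply, mul_comm]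

/-- The price as a superposition of the exponentials `s ↦ exp (∑ (2πi v_j - R_j) s_j)`, with a
weight that inherits the decay of the characteristic function. -/
theorem optionPrice_fourier_representation [IsFiniteMeasure P] (hX : Measurable X)
    {f : RVec D → ℝ} (hf : Measurable f) {α : ℝ}
    (hB1 : Integrable (dampenedPayoff R f) volume)
    (hB2 : Integrable (charFun (dampenedLaw P X R)) volume)
    (hB3 : Integrable (fun ω => Real.exp (inner ℝ R (X ω))) P)
    (hB4 : ∃ c₁ > (0 : ℝ), ∃ c₂ > (0 : ℝ), ∀ u : RVec D,
      ‖complexCharFun P X (fun j => (u j : ℂ) - Complex.I * (R j : ℂ))‖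
        ≤ c₁ * Real.exp (-(c₂ * ‖u‖ ^ α))) :
    (∀ s : RVec D, Integrable (fun ω => f (X ω - s)) P) ∧
    ∃ ψ : RVec D → ℂ, AEStronglyMeasurable ψ volume ∧
      (∃ C > (0 : ℝ), ∃ c > (0 : ℝ), ∀ v, ‖ψ v‖ ≤ C * Real.exp (-(c * ‖v‖ ^ α))) ∧
      ∀ s : RVec D, ((optionPrice P X f s : ℝ) : ℂ)
        = ∫ v, ψ v * Complex.exp (∑ j, (2 * Real.pi * Complex.I * v j - R j) * s j) := by
  have hν := isFiniteMeasure_dampenedLaw hX hB3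
  set g : RVec D → ℂ := fun x => ((dampenedPayoff R f x : ℝ) : ℂ) with hg
  have hgi : Integrable g := hB1.ofReal
  have hgm : StronglyMeasurable g := by
    refine Measurable.stronglyMeasurable (Complex.measurable_ofReal.comp ?_)
    unfold dampenedPayoff
    fun_prop
  have hgs : ∀ s, StronglyMeasurable fun x => g (x - s) := fun s =>
    hgm.comp_measurable (measurable_id.sub_const s)
  have hfg : ∀ s ω, ((f (X ω - s) : ℝ) : ℂ) = Complex.exp (-(inner ℝ R s : ℝ)) *
      (Real.exp (inner ℝ R (X ω)) • g (X ω - s)) := by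
    intro s ω
    have h1 : f (X ω - s) = Real.exp (-(inner ℝ R s)) * (Real.exp (inner ℝ R (X ω)) *
        dampenedPayoff R f (X ω - s)) := by
      rw [dampenedPayoff, ← mul_assoc, ← mul_assoc, ← Real.exp_add, ← Real.exp_add,
        inner_sub_right]
      rw [show -inner ℝ R s + inner ℝ R (X ω) + -(inner ℝ R (X ω) - inner ℝ R s) = 0 by ring,
        Real.exp_zero, one_mul]
    rw [h1, Complex.real_smul, hg]
    push_cast
    rfl
  refine ⟨fun s => ?_, fun v => 𝓕⁻ g v * fourierMeasure (dampenedLaw P X R) v, ?_, ?_, ?_⟩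
  · have h := ((integrable_dampenedLaw_iff hX (hgs s)).1
      (integrable_comp_sub_right hB2 hgi s)).const_mul (Complex.exp (-(inner ℝ R s : ℝ)))
    have h2 : Integrable (fun ω => ((f (X ω - s) : ℝ) : ℂ)) P := by
      simpa only [hfg] using h
    simpa using h2.re
  · exact (continuous_fourierInv hgi).aestronglyMeasurable.mul
      (integrable_fourierMeasure hB2).aestronglyMeasurable
  · obtain ⟨c₁, hc₁, c₂, hc₂, h⟩ := hB4
    have hI : 0 ≤ ∫ v, ‖g v‖ := integral_nonneg fun v => norm_nonneg _
    refine ⟨((∫ v, ‖g v‖) + 1) * c₁, by positivity, c₂ * (2 * Real.pi) ^ α, by positivity,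
      fun v => ?_⟩
    rw [norm_mul, mul_assoc]
    refine mul_le_mul ((norm_fourierInv_le g v).trans (by linarith)) ?_ (norm_nonneg _)
      (by positivity)
    rw [fourierMeasure, charFun_dampenedLaw hX]
    refine (h _).trans (le_of_eq ?_)
    rw [norm_smul, norm_neg, Real.norm_of_nonneg Real.two_pi_pos.le,
      Real.mul_rpow Real.two_pi_pos.le (norm_nonneg _), mul_assoc]
  · intro s
    rw [optionPrice, ← integral_complex_ofReal]
    simp only [hfg]
    rw [integral_const_mul, ← integral_dampenedLaw hX (hgs s),
      integral_comp_sub_right_eq hB2 hgi s, ← integral_const_mul]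
    congr with v
    rw [mul_left_comm, ← Complex.exp_add]
    congr 2
    rw [ofReal_inner_eq_sum, ofReal_inner_eq_sum, Finset.mul_sum, ← Finset.sum_neg_distrib,
      ← Finset.sum_add_distrib]
    exact Finset.sum_congr rfl fun j _ => by ring

end Price

/-! ### Growth, analytic continuation and interpolation error of the price -/

section Growth

variable {D : ℕ}

theorem norm_integral_mul_le_of_exp_bound {ψ : RVec D → ℂ} {C c α t M I : ℝ}
    (hC : 0 ≤ C) (hψ : ∀ v, ‖ψ v‖ ≤ C * Real.exp (-(c * ‖v‖ ^ α)))
    (hi : Integrable (fun y : RVec D => Real.exp (-(c * ‖y‖ ^ α) + t * ‖y‖)))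
    (hI : ∫ y : RVec D, Real.exp (-(c * ‖y‖ ^ α) + t * ‖y‖) ≤ I) (hM : 0 ≤ M)
    {h : RVec D → ℂ} (hh : ∀ v, ‖h v‖ ≤ M * Real.exp (t * ‖v‖)) :
    ‖∫ v, ψ v * h v‖ ≤ C * M * I := by
  calc ‖∫ v, ψ v * h v‖
      ≤ ∫ v : RVec D, C * M * Real.exp (-(c * ‖v‖ ^ α) + t * ‖v‖) := by
        refine norm_integral_le_of_norm_le (hi.const_mul _)
          (Filter.Eventually.of_forall fun v => ?_)
        rw [norm_mul, Real.exp_add]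
        calc ‖ψ v‖ * ‖h v‖
            ≤ (C * Real.exp (-(c * ‖v‖ ^ α))) * (M * Real.exp (t * ‖v‖)) :=
              mul_le_mul (hψ v) (hh v) (norm_nonneg _) (by positivity)
          _ = _ := by ring
    _ = C * M * ∫ v : RVec D, Real.exp (-(c * ‖v‖ ^ α) + t * ‖v‖) := integral_const_mul _ _
    _ ≤ C * M * I := by gcongr

theorem sum_abs_le (x : RVec D) : ∑ j, |x j| ≤ D * ‖x‖ := by
  calc ∑ j, |x j| ≤ ∑ _j : Fin D, ‖x‖ :=
        Finset.sum_le_sum fun j _ => by simpa using PiLp.norm_apply_le x j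
    _ = D * ‖x‖ := by simp

/-- The linear form `z ↦ ∑ (2πi v_j - R_j) z_j` on `ℂ^D`. -/
noncomputable def dampedPhase (R v : RVec D) : (Fin D → ℂ) →L[ℂ] ℂ :=
  ∑ j, (2 * Real.pi * Complex.I * v j - R j : ℂ) • ContinuousLinearMap.proj j

theorem dampedPhase_apply (R v : RVec D) (z : Fin D → ℂ) :
    dampedPhase R v z = ∑ j, (2 * Real.pi * Complex.I * v j - R j) * z j := by
  simp [dampedPhase]

theorem continuous_dampedPhase (R : RVec D) : Continuous (dampedPhase R) := by
  unfold dampedPhase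
  fun_prop

theorem norm_dampedPhase_apply_le (R v : RVec D) {z : Fin D → ℂ} {r : ℝ} (hr : 0 ≤ r)
    (hz : ∀ j, ‖z j‖ ≤ r) :
    ‖dampedPhase R v z‖ ≤ D * ‖R‖ * r + 2 * Real.pi * D * r * ‖v‖ := by
  rw [dampedPhase_apply]
  have hpi := Real.pi_pos
  calc ‖∑ j, (2 * Real.pi * Complex.I * v j - R j : ℂ) * z j‖
      ≤ ∑ j, (2 * Real.pi * |v j| + |R j|) * r := by
        refine norm_sum_le_of_le _ fun j _ => ?_
        rw [norm_mul]
        refine mul_le_mul ((norm_sub_le _ _).trans (le_of_eq ?_)) (hz j) (norm_nonneg _)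
          (by positivity)
        simp [abs_of_pos hpi]
    _ = (2 * Real.pi * ∑ j, |v j| + ∑ j, |R j|) * r := by
        rw [← Finset.sum_mul, Finset.sum_add_distrib, Finset.mul_sum]
    _ ≤ (2 * Real.pi * (D * ‖v‖) + D * ‖R‖) * r := by
        gcongr
        · exact sum_abs_le v
        · exact sum_abs_le R
    _ = _ := by ring

theorem norm_dampedPhase_le (R v : RVec D) :
    ‖dampedPhase R v‖ ≤ D * ‖R‖ + 2 * Real.pi * D * ‖v‖ := by
  have hpi := Real.pi_pos
  refine ContinuousLinearMap.opNorm_le_bound _ (by positivity) fun z => ?_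
  refine (norm_dampedPhase_apply_le R v (norm_nonneg z) (norm_le_pi_norm z)).trans (le_of_eq ?_)
  ring

theorem analyticOnNhd_integral_dampedPhase (R : RVec D) {ψ : RVec D → ℂ} {C c α : ℝ}
    (hC : 0 ≤ C) (hc : 0 < c) (hα : 1 < α) (hψm : AEStronglyMeasurable ψ volume)
    (hψ : ∀ v, ‖ψ v‖ ≤ C * Real.exp (-(c * ‖v‖ ^ α))) :
    AnalyticOnNhd ℂ (fun z => ∫ v, ψ v * Complex.exp (dampedPhase R v z)) Set.univ := by
  obtain ⟨K, hK, C₀, hC₀, hint⟩ := exists_integral_exp_neg_rpow_add_le D hα hc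
  have hℓ := (continuous_dampedPhase R).aestronglyMeasurable (μ := (volume : Measure (RVec D)))
  refine analyticOnNhd_integral_mul_exp hψm hℓ fun t => ?_
  have hpi := Real.pi_pos
  refine ((hint (|t| * (2 * Real.pi * D)) (by positivity)).1.const_mul
    (C * Real.exp (|t| * (D * ‖R‖)))).mono'
    (hψm.norm.mul (Real.continuous_exp.comp_aestronglyMeasurable (hℓ.norm.const_mul t)))
    (Filter.Eventually.of_forall fun v => ?_)
  rw [Real.norm_of_nonneg (by positivity), Real.exp_add]
  have h1 : Real.exp (t * ‖dampedPhase R v‖)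
      ≤ Real.exp (|t| * (D * ‖R‖)) * Real.exp (|t| * (2 * Real.pi * D) * ‖v‖) := by
    rw [← Real.exp_add]
    apply Real.exp_le_exp.2
    calc t * ‖dampedPhase R v‖ ≤ |t| * (D * ‖R‖ + 2 * Real.pi * D * ‖v‖) :=
          mul_le_mul (le_abs_self t) (norm_dampedPhase_le R v) (norm_nonneg _) (abs_nonneg _)
      _ = _ := by ring
  calc ‖ψ v‖ * Real.exp (t * ‖dampedPhase R v‖)
      ≤ (C * Real.exp (-(c * ‖v‖ ^ α))) *
        (Real.exp (|t| * (D * ‖R‖)) * Real.exp (|t| * (2 * Real.pi * D) * ‖v‖)) :=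
        mul_le_mul (hψ v) h1 (Real.exp_pos _).le (by positivity)
    _ = _ := by ring

theorem domainTransform_neg_self {𝕜 : Type*} [Field 𝕜] [CharZero 𝕜] (L z : 𝕜) :
    domainTransform (-L) L z = L * z := by
  unfold domainTransform
  ring

theorem domainTransformInv_neg_self {𝕜 : Type*} [Field 𝕜] [CharZero 𝕜] {L : 𝕜} (hL : L ≠ 0)
    (y : 𝕜) : domainTransformInv (-L) L y = y / L := by
  have : L - -L ≠ 0 := by
    rw [sub_neg_eq_add, ← two_mul]
    exact mul_ne_zero two_ne_zero hL
  unfold domainTransformInv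
  field_simp
  ring

theorem norm_le_of_mem_bernsteinEllipse {ϱ : ℝ} (hϱ : 1 < ϱ) {z : ℂ}
    (hz : z ∈ bernsteinEllipse ϱ) : ‖z‖ ≤ ϱ := by
  have h0 : 0 < ϱ := by linarith
  have hinv : ϱ⁻¹ < 1 := inv_lt_one_of_one_lt₀ hϱ
  have hA : 0 < (ϱ + ϱ⁻¹) / 2 := by positivity
  have hB : 0 < (ϱ - ϱ⁻¹) / 2 := by linarith
  have hz' : (z.re / ((ϱ + ϱ⁻¹) / 2)) ^ 2 + (z.im / ((ϱ - ϱ⁻¹) / 2)) ^ 2 < 1 := hz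
  have h1 : |z.re| ≤ (ϱ + ϱ⁻¹) / 2 := by
    have : |z.re / ((ϱ + ϱ⁻¹) / 2)| ≤ 1 := by
      rw [← sq_le_one_iff_abs_le_one]
      nlinarith [sq_nonneg (z.im / ((ϱ - ϱ⁻¹) / 2))]
    rwa [abs_div, abs_of_pos hA, div_le_one hA] at this
  have h2 : |z.im| ≤ (ϱ - ϱ⁻¹) / 2 := by
    have : |z.im / ((ϱ - ϱ⁻¹) / 2)| ≤ 1 := by
      rw [← sq_le_one_iff_abs_le_one]
      nlinarith [sq_nonneg (z.re / ((ϱ + ϱ⁻¹) / 2))]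
    rwa [abs_div, abs_of_pos hB, div_le_one hB] at this
  have h3 := Complex.norm_le_abs_re_add_abs_im z
  linarith

/-- The growth of the analytic extension on the generalized Bernstein ellipses of a fixed shape. -/
theorem exists_norm_integral_dampedPhase_le (R : RVec D) {ψ : RVec D → ℂ} {C c α : ℝ}
    (hC : 0 < C) (hc : 0 < c) (hα : 1 < α)
    (hψ : ∀ v, ‖ψ v‖ ≤ C * Real.exp (-(c * ‖v‖ ^ α)))
    {ϱ : Fin D → ℝ} (hϱ : ∀ i, 1 < ϱ i) :
    ∃ c₃ > (0 : ℝ), ∃ c₄ > (0 : ℝ), ∀ L > (0 : ℝ), ∀ z ∈ generalizedBernsteinEllipse D L ϱ,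
      ‖∫ v, ψ v * Complex.exp (dampedPhase R v z)‖
        ≤ c₃ * Real.exp (c₄ * L ^ (α / (α - 1))) := by
  obtain ⟨K, hK, C₀, hC₀, hint⟩ := exists_integral_exp_neg_rpow_add_le D hα hc
  set ϑ := α / (α - 1) with hϑ
  have hα1 : 0 < α - 1 := by linarith
  have hϑ1 : 1 ≤ ϑ := by rw [hϑ, le_div_iff₀ hα1]; linarith
  have hpi := Real.pi_pos
  set S := ∑ i, ϱ i with hS
  have hS0 : 0 ≤ S := Finset.sum_nonneg fun i _ => by linarith [hϱ i]
  set A := D * ‖R‖ * S with hA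
  have hA0 : 0 ≤ A := by positivity
  set T := 2 * Real.pi * D * S with hT
  have hT0 : 0 ≤ T := by positivity
  refine ⟨C * Real.exp A * K, by positivity, A + C₀ * T ^ ϑ + 1, by positivity,
    fun L hL z hz => ?_⟩
  have hzL : ∀ j, ‖z j‖ ≤ L * S := by
    intro j
    obtain ⟨y, hy, hyz⟩ := hz j
    rw [← hyz, domainTransform_neg_self, norm_mul, Complex.norm_real, Real.norm_of_nonneg hL.le]
    have h1 := norm_le_of_mem_bernsteinEllipse (hϱ j) hy
    have h2 : ϱ j ≤ S := Finset.single_le_sum (f := ϱ)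
      (fun i _ => by linarith [hϱ i]) (Finset.mem_univ j)
    gcongr
    linarith
  have hLϑ : L ≤ 1 + L ^ ϑ := by
    rcases le_total L 1 with h | h
    · have := Real.rpow_nonneg hL.le ϑ
      linarith
    · have := Real.self_le_rpow_of_one_le h hϑ1
      linarith
  obtain ⟨hi, hI⟩ := hint (L * T) (by positivity)
  have h := norm_integral_mul_le_of_exp_bound hC.le hψ hi hI (Real.exp_pos (A * L)).le
    (h := fun v => Complex.exp (dampedPhase R v z)) (fun v => by
      rw [Complex.norm_exp, ← Real.exp_add]
      apply Real.exp_le_exp.2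
      refine (Complex.re_le_norm _).trans
        ((norm_dampedPhase_apply_le R v (by positivity) hzL).trans (le_of_eq ?_))
      rw [hA, hT]
      ring)
  refine h.trans ?_
  rw [Real.mul_rpow hL.le hT0]
  have e1 : Real.exp (A * L) ≤ Real.exp A * Real.exp (A * L ^ ϑ) := by
    rw [← Real.exp_add]
    apply Real.exp_le_exp.2
    nlinarith
  have e2 : Real.exp (A * L ^ ϑ) * Real.exp (C₀ * (L ^ ϑ * T ^ ϑ))
      ≤ Real.exp ((A + C₀ * T ^ ϑ + 1) * L ^ ϑ) := by
    rw [← Real.exp_add]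
    apply Real.exp_le_exp.2
    have := Real.rpow_nonneg hL.le ϑ
    nlinarith
  calc C * Real.exp (A * L) * (K * Real.exp (C₀ * (L ^ ϑ * T ^ ϑ)))
      ≤ C * (Real.exp A * Real.exp (A * L ^ ϑ)) * (K * Real.exp (C₀ * (L ^ ϑ * T ^ ϑ))) := by
        gcongr
    _ = C * Real.exp A * K * (Real.exp (A * L ^ ϑ) * Real.exp (C₀ * (L ^ ϑ * T ^ ϑ))) := by ring
    _ ≤ _ := by gcongr

end Growth

section Interpolation

variable {D : ℕ}

theorem integrable_mul_exp_dampedPhase (R : RVec D) {ψ : RVec D → ℂ} {C c α : ℝ}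
    (hC : 0 ≤ C) (hc : 0 < c) (hα : 1 < α) (hψm : AEStronglyMeasurable ψ volume)
    (hψ : ∀ v, ‖ψ v‖ ≤ C * Real.exp (-(c * ‖v‖ ^ α))) (z : Fin D → ℂ) :
    Integrable fun v => ψ v * Complex.exp (dampedPhase R v z) := by
  obtain ⟨K, hK, C₀, hC₀, hint⟩ := exists_integral_exp_neg_rpow_add_le D hα hc
  have hpi := Real.pi_pos
  have hm : Continuous fun v => Complex.exp (dampedPhase R v z) :=
    Complex.continuous_exp.comp ((continuous_dampedPhase R).clm_apply continuous_const)
  refine ((hint (2 * Real.pi * D * ‖z‖) (by positivity)).1.const_mul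
    (C * Real.exp (D * ‖R‖ * ‖z‖))).mono' (hψm.mul hm.aestronglyMeasurable)
    (Filter.Eventually.of_forall fun v => ?_)
  rw [norm_mul, Complex.norm_exp, Real.exp_add]
  have h1 : Real.exp (dampedPhase R v z).re
      ≤ Real.exp (D * ‖R‖ * ‖z‖) * Real.exp (2 * Real.pi * D * ‖z‖ * ‖v‖) := by
    rw [← Real.exp_add]
    exact Real.exp_le_exp.2 ((Complex.re_le_norm _).trans
      (norm_dampedPhase_apply_le R v (norm_nonneg z) (norm_le_pi_norm z)))
  calc ‖ψ v‖ * Real.exp (dampedPhase R v z).re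
      ≤ (C * Real.exp (-(c * ‖v‖ ^ α))) *
        (Real.exp (D * ‖R‖ * ‖z‖) * Real.exp (2 * Real.pi * D * ‖z‖ * ‖v‖)) :=
        mul_le_mul (hψ v) h1 (Real.exp_pos _).le (by positivity)
    _ = _ := by ring

theorem chebInterp_eq_sum_cardinal {L : ℝ} (hL : 0 < L) (n : ℕ) (V : RVec D → ℝ) (s : RVec D) :
    chebInterp L n V s = ∑ k : Fin D → Fin (n + 1),
      V (WithLp.toLp 2 fun i => L * chebNode n k i) * ∏ i, chebCardinal n (k i) (s i / L) := by
  rw [chebInterp, chebInterpUnit_eq_sum_cardinal]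
  simp only [domainTransform_neg_self, domainTransformInv_neg_self hL.ne']

/-- For `ϑ ≥ 2` the quantity `C * (T * sinh (4 b)) ^ ϑ` is of smaller order than `b` as `b → 0`. -/
theorem exists_rpow_sinh_le {ϑ C T : ℝ} (hϑ : 2 ≤ ϑ) (hC : 0 < C) (hT : 0 ≤ T) :
    ∃ b > (0 : ℝ),
      C * (T * ((Real.exp b ^ 4 - (Real.exp b ^ 4)⁻¹) / 2)) ^ ϑ ≤ b / 2 := by
  -- `8` comes from `sinh (4 b) ≤ 8 b` for `b ≤ 1 / 4`
  set C₁ := C * (T * 8) ^ ϑ + 1 with hC₁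
  have hC₁0 : 0 < C₁ := by positivity
  refine ⟨min (1 / 4) (1 / (2 * C₁)), by positivity, ?_⟩
  set b := min (1 / 4) (1 / (2 * C₁)) with hb
  have hb0 : 0 < b := by positivity
  have hb1 : b ≤ 1 / 4 := min_le_left _ _
  have hb2 : b ≤ 1 / (2 * C₁) := min_le_right _ _
  have he : Real.exp b ^ 4 = Real.exp (4 * b) := by
    rw [← Real.exp_nat_mul]
    norm_num
  have hlo : 0 ≤ (Real.exp (4 * b) - Real.exp (-(4 * b))) / 2 := by
    have : Real.exp (-(4 * b)) ≤ Real.exp (4 * b) := Real.exp_le_exp.2 (by linarith)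
    linarith
  have hup : (Real.exp (4 * b) - Real.exp (-(4 * b))) / 2 ≤ 8 * b := by
    have h1 := Real.abs_exp_sub_one_sub_id_le (x := 4 * b) (by
      rw [abs_of_pos (by positivity)]; linarith)
    have h2 := Real.add_one_le_exp (-(4 * b))
    have h3 := (abs_le.1 h1).2
    nlinarith
  rw [he, ← Real.exp_neg]
  calc C * (T * ((Real.exp (4 * b) - Real.exp (-(4 * b))) / 2)) ^ ϑ
      ≤ C * (T * (8 * b)) ^ ϑ := by gcongr
    _ = C * (T * 8) ^ ϑ * b ^ ϑ := by
        rw [← mul_assoc T, Real.mul_rpow (by positivity) hb0.le]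
        ring
    _ ≤ C₁ * b ^ (2 : ℝ) := by
        refine mul_le_mul (by linarith)
          (Real.rpow_le_rpow_of_exponent_ge hb0 (by linarith) hϑ) (by positivity) hC₁0.le
    _ = C₁ * b * b := by rw [Real.rpow_two]; ring
    _ ≤ 1 / 2 * b := by
        refine mul_le_mul_of_nonneg_right ?_ hb0.le
        rw [le_div_iff₀ (by positivity)] at hb2
        linarith
    _ = b / 2 := by ring

/-- Exponential convergence of Chebyshev interpolation for a superposition of exponentials, with
the same constant `b` governing the growth in `L` and the decay in `n`. On ellipses of parameter
`exp (4 b)` the superposition grows like `exp (O(L) + C (L sinh (4 b)) ^ ϑ)`, and `ϑ > 1` makes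
the second term at most `(b / 2) L ^ ϑ` for small `b`. -/
theorem exists_abs_sub_chebInterp_le (R : RVec D) {ψ : RVec D → ℂ} {C c α : ℝ}
    (hC : 0 < C) (hc : 0 < c) (hα : 1 < α) (hα2 : 2 ≤ α / (α - 1))
    (hψm : AEStronglyMeasurable ψ volume)
    (hψ : ∀ v, ‖ψ v‖ ≤ C * Real.exp (-(c * ‖v‖ ^ α))) {V : RVec D → ℝ}
    (hV : ∀ s : RVec D, ((V s : ℝ) : ℂ)
      = ∫ v, ψ v * Complex.exp (∑ j, (2 * Real.pi * Complex.I * v j - R j) * s j)) :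
    ∃ a > (0 : ℝ), ∃ b > (0 : ℝ), ∀ L > (0 : ℝ), ∀ n : ℕ, 1 ≤ n → ∀ s ∈ cube D L,
      |V s - chebInterp L n V s| ≤ a * Real.exp (b * (L ^ (α / (α - 1)) - (n + 1 : ℝ))) := by
  obtain ⟨K, hK, C₀, hC₀, hint⟩ := exists_integral_exp_neg_rpow_add_le D hα hc
  set ϑ := α / (α - 1) with hϑ
  have hpi := Real.pi_pos
  obtain ⟨b, hb, hbC⟩ := exists_rpow_sinh_le (T := 2 * Real.pi * D) hα2 hC₀ (by positivity)
  have hτ : 1 < Real.exp b := Real.one_lt_exp_iff.2 hb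
  obtain ⟨C₁, hC₁, herr⟩ := exists_norm_exp_sum_sub_interp_le D hτ
  set A := (Real.exp b ^ 4 + (Real.exp b ^ 4)⁻¹) / 2 with hA
  set B := (Real.exp b ^ 4 - (Real.exp b ^ 4)⁻¹) / 2 with hB
  have hA0 : 0 ≤ A := by positivity
  have hB0 : 0 ≤ B := by
    have h1 : 1 < Real.exp b ^ 4 := one_lt_pow₀ hτ (by norm_num)
    have h2 : (Real.exp b ^ 4)⁻¹ < 1 := inv_lt_one_of_one_lt₀ h1
    rw [hB]
    linarith
  -- the linear term `D ‖R‖ A L` in the exponent is absorbed into `(b / 2) L ^ ϑ`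
  obtain ⟨C₂, -, hY⟩ := exists_mul_le_rpow_add_rpow (α := ϑ) (c := b / 2) (by linarith)
    (by positivity)
  set E := C₂ * (D * ‖R‖ * A) ^ (ϑ / (ϑ - 1)) with hE
  refine ⟨C * (C₁ * Real.exp E) * K * Real.exp b, by positivity, b, hb, fun L hL n hn s hs => ?_⟩
  set x : Fin D → ℝ := fun i => s i / L with hx
  have hx1 : ∀ i, |x i| ≤ 1 := by
    intro i
    rw [hx, abs_div, abs_of_pos hL, div_le_one hL]
    exact abs_le.2 (hs i)
  set w : RVec D → Fin D → ℂ := fun v i => (2 * Real.pi * Complex.I * v i - R i) * L with hw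
  set h : RVec D → ℂ := fun v => Complex.exp (∑ i, w v i * x i) -
    ∑ k : Fin D → Fin (n + 1), Complex.exp (∑ i, w v i * (chebNode n k i : ℝ)) *
      (∏ i, chebCardinal n (k i) (x i) : ℝ) with hh
  have hVi : ∀ y : Fin D → ℝ,
      Integrable fun v => ψ v * Complex.exp (∑ i, w v i * (y i : ℝ)) := by
    intro y
    refine (integrable_mul_exp_dampedPhase R hC.le hc hα hψm hψ
      (fun i => (L : ℂ) * y i)).congr (Filter.Eventually.of_forall fun v => ?_)
    simp only [dampedPhase_apply, hw, mul_assoc]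
  have hVw : ∀ y : Fin D → ℝ, ((V (WithLp.toLp 2 fun i => L * y i) : ℝ) : ℂ)
      = ∫ v, ψ v * Complex.exp (∑ i, w v i * (y i : ℝ)) := by
    intro y
    rw [hV]
    simp only [hw, Complex.ofReal_mul, mul_assoc]
  have hs_eq : s = WithLp.toLp 2 fun i => L * x i := by
    ext i
    simp only [hx]
    field_simp
  have hdiff : ((V s - chebInterp L n V s : ℝ) : ℂ) = ∫ v, ψ v * h v := by
    have e : ∀ v, ψ v * h v = ψ v * Complex.exp (∑ i, w v i * x i) -
        ∑ k : Fin D → Fin (n + 1), ψ v * Complex.exp (∑ i, w v i * (chebNode n k i : ℝ)) *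
          (∏ i, chebCardinal n (k i) (x i) : ℝ) := by
      intro v
      rw [hh, mul_sub, Finset.mul_sum]
      simp only [mul_assoc]
    simp only [e]
    rw [integral_sub (hVi x) (integrable_finsetSum _ fun k _ => (hVi _).mul_const _),
      integral_finsetSum _ fun k _ => (hVi _).mul_const _]
    simp only [integral_mul_const, ← hVw]
    rw [← hs_eq, chebInterp_eq_sum_cardinal hL, Complex.ofReal_sub, Complex.ofReal_sum]
    simp only [Complex.ofReal_mul]
    rfl
  have hhb : ∀ v, ‖h v‖ ≤ C₁ * Real.exp (D * ‖R‖ * A * L) * (Real.exp b)⁻¹ ^ n *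
      Real.exp (L * (2 * Real.pi * D * B) * ‖v‖) := by
    intro v
    refine (herr n hn (w v) x hx1).trans ?_
    have hexp : ∑ i, (|(w v i).re| * A + |(w v i).im| * B)
        ≤ D * ‖R‖ * A * L + L * (2 * Real.pi * D * B) * ‖v‖ := by
      have e : ∀ i, |(w v i).re| * A + |(w v i).im| * B
          = A * L * |R i| + L * (2 * Real.pi * B) * |v i| := by
        intro i
        have hre : (w v i).re = -R i * L := by simp [hw]
        have him : (w v i).im = 2 * Real.pi * v i * L := by simp [hw]
        rw [hre, him, abs_mul, abs_neg, abs_mul, abs_mul, abs_of_pos hL,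
          abs_of_pos Real.two_pi_pos]
        ring
      simp only [e]
      rw [Finset.sum_add_distrib, ← Finset.mul_sum, ← Finset.mul_sum]
      calc A * L * ∑ i, |R i| + L * (2 * Real.pi * B) * ∑ i, |v i|
          ≤ A * L * (D * ‖R‖) + L * (2 * Real.pi * B) * (D * ‖v‖) := by
            gcongr
            · exact sum_abs_le R
            · exact sum_abs_le v
        _ = _ := by ring
    calc _ ≤ C₁ * Real.exp (D * ‖R‖ * A * L + L * (2 * Real.pi * D * B) * ‖v‖) *
          (Real.exp b)⁻¹ ^ n := by gcongr
      _ = _ := by rw [Real.exp_add]; ring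
  obtain ⟨hi, hI⟩ := hint (L * (2 * Real.pi * D * B)) (by positivity)
  have hfin := norm_integral_mul_le_of_exp_bound hC.le hψ hi hI (by positivity) hhb
  rw [← hdiff, Complex.norm_real, Real.norm_eq_abs] at hfin
  refine hfin.trans ?_
  have h1 : Real.exp (D * ‖R‖ * A * L) ≤ Real.exp E * Real.exp (b / 2 * L ^ ϑ) := by
    rw [← Real.exp_add]
    apply Real.exp_le_exp.2
    have := hY (D * ‖R‖ * A) L (by positivity) hL.le
    rw [hE]
    linarith
  have h2 : Real.exp (C₀ * (L * (2 * Real.pi * D * B)) ^ ϑ) ≤ Real.exp (b / 2 * L ^ ϑ) := by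
    apply Real.exp_le_exp.2
    rw [Real.mul_rpow hL.le (by positivity)]
    have := mul_le_mul_of_nonneg_right hbC (Real.rpow_nonneg hL.le ϑ)
    linarith
  have h3 : (Real.exp b)⁻¹ ^ n = Real.exp b * Real.exp (-(b * (n + 1 : ℝ))) := by
    rw [← Real.exp_neg, ← Real.exp_nat_mul, ← Real.exp_add]
    congr 1
    ring
  calc C * (C₁ * Real.exp (D * ‖R‖ * A * L) * (Real.exp b)⁻¹ ^ n) *
        (K * Real.exp (C₀ * (L * (2 * Real.pi * D * B)) ^ ϑ))
      ≤ C * (C₁ * (Real.exp E * Real.exp (b / 2 * L ^ ϑ)) * (Real.exp b)⁻¹ ^ n) *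
        (K * Real.exp (b / 2 * L ^ ϑ)) := by gcongr
    _ = C * (C₁ * Real.exp E) * K * Real.exp b *
        (Real.exp (b / 2 * L ^ ϑ) * Real.exp (b / 2 * L ^ ϑ) * Real.exp (-(b * (n + 1 : ℝ)))) := by
        rw [h3]; ring
    _ = _ := by
        rw [← Real.exp_add, ← Real.exp_add]
        congr 2
        ring

end Interpolation

theorem mainTheorem7 {D : ℕ} (hD : 1 ≤ D)
    {Ω : Type*} [MeasurableSpace Ω] (P : Measure Ω) [IsProbabilityMeasure P]
    (X : Ω → RVec D) (hX : Measurable X)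
    (f : RVec D → ℝ) (hf : Measurable f) (hf0 : ∀ x, 0 ≤ f x)
    (R : RVec D) (α : ℝ) (hα : α ∈ Set.Ioc (1 : ℝ) 2)
    (hB1 : Integrable (dampenedPayoff R f) volume)
    (hB2 : Integrable (charFun (dampenedLaw P X R)) volume)
    (hB3 : Integrable (fun ω => Real.exp (inner ℝ R (X ω))) P)
    (hB4 : ∃ c₁ > (0 : ℝ), ∃ c₂ > (0 : ℝ), ∀ u : RVec D,
      ‖complexCharFun P X (fun j => (u j : ℂ) - Complex.I * (R j : ℂ))‖
        ≤ c₁ * Real.exp (-(c₂ * ‖u‖ ^ α))) :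
    -- the price is a finite expectation at every `s`
    (∀ s : RVec D, Integrable (fun ω => f (X ω - s)) P) ∧
    -- the condition on the domain size dependence, with `ϑ = α / (α - 1)`
    2 ≤ α / (α - 1) ∧
    (∃ a > (0 : ℝ), ∃ b > (0 : ℝ), ∀ L > (0 : ℝ), ∀ n : ℕ, 1 ≤ n → ∀ N : ℕ, N = (n + 1) ^ D →
      ∀ s ∈ cube D L,
        |optionPrice P X f s - chebInterp L n (optionPrice P X f) s|
          ≤ a * Real.exp (b * (L ^ (α / (α - 1)) - (N : ℝ) ^ (1 / (D : ℝ))))) ∧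
    -- the analytic extension to generalized Bernstein ellipses and its growth in `L`
    (∀ ϱ : Fin D → ℝ, (∀ i, 1 < ϱ i) →
      ∃ c₃ > (0 : ℝ), ∃ c₄ > (0 : ℝ), ∀ L > (0 : ℝ), ∃ F : (Fin D → ℂ) → ℂ,
        AnalyticOnNhd ℂ F (generalizedBernsteinEllipse D L ϱ) ∧
        (∀ s ∈ cube D L, F (fun i => ((s i : ℝ) : ℂ)) = ((optionPrice P X f s : ℝ) : ℂ)) ∧
        ∀ z ∈ generalizedBernsteinEllipse D L ϱ,
          ‖F z‖ ≤ c₃ * Real.exp (c₄ * L ^ (α / (α - 1)))) := by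
  obtain ⟨hα1, hα2⟩ := hα
  have hϑ : 2 ≤ α / (α - 1) := by
    rw [le_div_iff₀ (by linarith)]
    linarith
  obtain ⟨hfin, ψ, hψm, ⟨C, hC, c, hc, hψ⟩, hV⟩ :=
    optionPrice_fourier_representation hX hf hB1 hB2 hB3 hB4
  refine ⟨hfin, hϑ, ?_, fun ϱ hϱ => ?_⟩
  · obtain ⟨a, ha, b, hb, h⟩ := exists_abs_sub_chebInterp_le R hC hc hα1 hϑ hψm hψ hV
    refine ⟨a, ha, b, hb, fun L hL n hn N hN s hs => ?_⟩
    have hroot : (N : ℝ) ^ (1 / (D : ℝ)) = n + 1 := by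
      rw [hN, one_div, Nat.cast_pow, Real.pow_rpow_inv_natCast (by positivity) (by omega)]
      push_cast
      rfl
    rw [hroot]
    exact h L hL n hn s hs
  · obtain ⟨c₃, hc₃, c₄, hc₄, h⟩ := exists_norm_integral_dampedPhase_le R hC hc hα1 hψ hϱ
    refine ⟨c₃, hc₃, c₄, hc₄, fun L hL =>
      ⟨fun z => ∫ v, ψ v * Complex.exp (dampedPhase R v z), ?_, fun s _ => ?_, h L hL⟩⟩
    · exact (analyticOnNhd_integral_dampedPhase R hC.le hc hα1 hψm hψ).mono (Set.subset_univ _)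
    · rw [hV]
      simp only [dampedPhase_apply]
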